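/- Let $L,\alpha,\beta>0$, let $\Omega_L=\mathbb R\times(0,L)$, and let $\Gamma=\mathbb R\times\{0\}$. Let $\mathcal V(\Omega_L)$ be the set of all vector fields $v\in C^\infty(\overline{\Omega_L};\mathbb R^2)$ with $\operatorname{div}v=0$ in $\Omega_L$, $v\cdot n=0$ on $\Gamma$ ($n$ being the unit normal), and $\operatorname{supp}v$ a compact subset of $\Omega_L\cup\Gamma$. For pairs $(u,g)$ put $$\|(u,g)\|_{V_L}^2=\|Du\|_{L^2(\Omega_L)}^2+\alpha\|g\|_{L^2(\Gamma)}^2,\qquad \|(u,g)\|_{H_L}^2=\|u\|_{L^2(\Omega_L)}^2+\beta\|g\|_{L^2(\Gamma)}^2,$$ where $Du=\tfrac12(\nabla u+(\nabla u)^{T})$ is the weak symmetric gradient and matrices carry the Frobenius norm. Let $V_L$ be the closure of $\{(v,v|_\Gamma):v\in\mathcal V(\Omega_L)\}$ in the norm $\|\cdot\|_{V_L}$, taken among the pairs $(u,g)\in L^2(\Omega_L;\mathbb R^2)\times L^2(\Gamma;\mathbb R^2)$ with $Du\in L^2(\Omega_L)$, and let $H_L$ be its closure in the norm $\|\cdot\|_{H_L}$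 in $L^2(\Omega_L;\mathbb R^2)\times L^2(\Gamma;\mathbb R^2)$. Then every sequence in $\mathcal V(\Omega_L)$ that is Cauchy in the norm $\|\cdot\|_{V_L}$ converges in this norm to an element of $V_L$ (so that $V_L$ is the completion of $\mathcal V(\Omega_L)$). Moreover, for every $(u,g)\in V_L$ we have $u\in W^{1,2}(\Omega_L)$, $(u,g)\in H_L$, and $$\|u\|_{W^{1,2}(\Omega_L)}^2\le 8\Bigl(1+\frac{4L^2}{\pi^2}\Bigr)\|(u,g)\|_{V_L}^2,\qquad \|(u,g)\|_{H_L}^2\le\Lambda\,\|(u,g)\|_{V_L}^2,\qquad \Lambda=\frac{32L^2}{\pi^2}+\beta\min\Bigl\{\frac1\alpha,\,8L\Bigr\},$$ where $\|u\|_{W^{1,2}(\Omega_L)}^2=\|u\|_{L^2(\Omega_L)}^2+\|\nabla u\|_{L^2(\Omega_L)}^2$. -/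

import Mathlib

open MeasureTheory Filter Topology
open scoped ContDiff

namespace SlipChannel

/-- The Euclidean space in which velocities take their values. -/
abbrev Vel : Type := EuclideanSpace ℝ (Fin 2)

/-- Real `2 × 2` matrices with the Frobenius norm; the entry in row `i` and column `j` has
index `(i, j)`. -/
abbrev Mat2 : Type := EuclideanSpace ℝ (Fin 2 × Fin 2)

/-- The open channel `ℝ × (0, L)`. -/
def channel (L : ℝ) : Set (ℝ × ℝ) := {p | 0 < p.2 ∧ p.2 < L}

/-- The coordinate directions of the plane: `dir 0 = (1, 0)` and `dir 1 = (0, 1)`. -/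
def dir (j : Fin 2) : ℝ × ℝ := if j = 0 then (1, 0) else (0, 1)

/-- The partial derivative `∂ⱼ φ` of a scalar function on the plane. -/
noncomputable def pderiv (j : Fin 2) (φ : ℝ × ℝ → ℝ) (p : ℝ × ℝ) : ℝ := fderiv ℝ φ p (dir j)

/-- Scalar test functions: smooth, with compact support contained in the open channel. -/
def IsTest (L : ℝ) (φ : ℝ × ℝ → ℝ) : Prop :=
  ContDiff ℝ ∞ φ ∧ HasCompactSupport φ ∧ tsupport φ ⊆ channel L

/-- `G` is the weak gradient of `u` in the channel, the entry `(i, j)` being `∂ⱼ uᵢ`. -/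
def IsWeakGrad (L : ℝ) (u : ℝ × ℝ → Vel) (G : ℝ × ℝ → Mat2) : Prop :=
  LocallyIntegrableOn u (channel L) ∧ LocallyIntegrableOn G (channel L) ∧
  ∀ φ, IsTest L φ → ∀ i j : Fin 2,
    ∫ p in channel L, G p (i, j) * φ p = - ∫ p in channel L, u p i * pderiv j φ p

/-- `S` is the weak symmetric gradient `D u` of `u` in the channel, the entry `(i, j)` being
`(∂ⱼ uᵢ + ∂ᵢ uⱼ) / 2`. The individual derivatives of `u` are not required to be functions. -/
def IsWeakSymGrad (L : ℝ) (u : ℝ × ℝ → Vel) (S : ℝ × ℝ → Mat2) : Prop :=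
  LocallyIntegrableOn u (channel L) ∧ LocallyIntegrableOn S (channel L) ∧
  ∀ φ, IsTest L φ → ∀ i j : Fin 2,
    ∫ p in channel L, S p (i, j) * φ p =
      - ∫ p in channel L, (u p i * pderiv j φ p + u p j * pderiv i φ p) / 2

open Classical in
/-- The weak gradient of `u` (unique almost everywhere); zero if there is none. -/
noncomputable def weakGrad (L : ℝ) (u : ℝ × ℝ → Vel) : ℝ × ℝ → Mat2 :=
  if h : ∃ G, IsWeakGrad L u G then h.choose else 0

open Classical in
/-- The weak symmetric gradient of `u` (unique almost everywhere); zero if there is none. -/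
noncomputable def weakSymGrad (L : ℝ) (u : ℝ × ℝ → Vel) : ℝ × ℝ → Mat2 :=
  if h : ∃ S, IsWeakSymGrad L u S then h.choose else 0

/-- Membership in `L²` of the channel, for functions with values in a normed space. -/
def MemL2 {F : Type*} [NormedAddCommGroup F] (L : ℝ) (u : ℝ × ℝ → F) : Prop :=
  MemLp u 2 (volume.restrict (channel L))

/-- The Sobolev space `W^{1,2}` of the channel. -/
def MemW12 (L : ℝ) (u : ℝ × ℝ → Vel) : Prop :=
  MemL2 L u ∧ ∃ G, IsWeakGrad L u G ∧ MemL2 L G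

/-- The square of the norm of `W^{1,2}` of the channel. -/
noncomputable def w12NormSq (L : ℝ) (u : ℝ × ℝ → Vel) : ℝ :=
  (∫ p in channel L, ‖u p‖ ^ 2) + ∫ p in channel L, ‖weakGrad L u p‖ ^ 2

/-- The pointwise restriction of `v` to the lower wall `ℝ × {0}`, which is identified with `ℝ`. -/
def restrictWall (v : ℝ × ℝ → Vel) : ℝ → Vel := fun x => v (x, 0)

/-- The smooth class: fields that are smooth up to the boundary of the channel and divergence free,
whose normal component vanishes on the lower wall, and whose support is a compact subset of
`ℝ × [0, L)`, so that they vanish near the upper wall. Only values on `ℝ × [0, L]` matter. -/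
def MemSmooth (L : ℝ) (v : ℝ × ℝ → Vel) : Prop :=
  ContDiffOn ℝ ∞ v (closure (channel L)) ∧
  (∀ p ∈ channel L, pderiv 0 (fun q => v q 0) p + pderiv 1 (fun q => v q 1) p = 0) ∧
  (∀ x : ℝ, v (x, 0) 1 = 0) ∧
  ∃ K : Set (ℝ × ℝ), IsCompact K ∧ K ⊆ {p | 0 ≤ p.2 ∧ p.2 < L} ∧
    ∀ p ∈ closure (channel L), p ∉ K → v p = 0

/-- The square of the `V_L`-norm of a pair: `‖D u‖² + α ‖g‖²`. -/
noncomputable def vNormSq (L α : ℝ) (u : ℝ × ℝ → Vel) (g : ℝ → Vel) : ℝ :=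
  (∫ p in channel L, ‖weakSymGrad L u p‖ ^ 2) + α * ∫ x : ℝ, ‖g x‖ ^ 2

/-- The square of the `H_L`-norm of a pair: `‖u‖² + β ‖g‖²`. -/
noncomputable def hNormSq (L β : ℝ) (u : ℝ × ℝ → Vel) (g : ℝ → Vel) : ℝ :=
  (∫ p in channel L, ‖u p‖ ^ 2) + β * ∫ x : ℝ, ‖g x‖ ^ 2

/-- The pairs `(u, g)` among which the closure defining `V_L` is taken: `u`, its weak symmetric
gradient, and `g` are square integrable. No relation between `u` and `g` is imposed. -/
def FiniteEnergy (L : ℝ) (u : ℝ × ℝ → Vel) (g : ℝ → Vel) : Prop :=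
  MemL2 L u ∧ (∃ S, IsWeakSymGrad L u S ∧ MemL2 L S) ∧ MemLp g 2 volume

/-- The space `V_L`: the closure in the `V_L`-norm of the pairs `(v, v|_Γ)` with `v` in the
smooth class. -/
def MemV (L α : ℝ) (u : ℝ × ℝ → Vel) (g : ℝ → Vel) : Prop :=
  FiniteEnergy L u g ∧ ∃ v : ℕ → ℝ × ℝ → Vel, (∀ n, MemSmooth L (v n)) ∧
    Tendsto (fun n => vNormSq L α (u - v n) (g - restrictWall (v n))) atTop (𝓝 0)

/-- The space `H_L`: the closure in the `H_L`-norm of the pairs `(v, v|_Γ)` with `v` in the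
smooth class. -/
def MemH (L β : ℝ) (u : ℝ × ℝ → Vel) (g : ℝ → Vel) : Prop :=
  (MemL2 L u ∧ MemLp g 2 volume) ∧ ∃ v : ℕ → ℝ × ℝ → Vel, (∀ n, MemSmooth L (v n)) ∧
    Tendsto (fun n => hNormSq L β (u - v n) (g - restrictWall (v n))) atTop (𝓝 0)

/-- A sequence in the smooth class that is Cauchy in the `V_L`-norm. -/
def IsVCauchy (L α : ℝ) (v : ℕ → ℝ × ℝ → Vel) : Prop :=
  (∀ n, MemSmooth L (v n)) ∧ ∀ ε > 0, ∃ N, ∀ m ≥ N, ∀ n ≥ N,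
    vNormSq L α (v m - v n) (restrictWall (v m) - restrictWall (v n)) < ε

end SlipChannel

/-! ### Square-integrable functions and sequences -/

section SquareIntegrable

variable {X F : Type*} [MeasurableSpace X] {μ : Measure X} [NormedAddCommGroup F]

/-! Everything rests on three inequalities for smooth fields `v`, which then pass to limits.

Korn: pointwise `2|Dv|² - |∇v|² = (div v)² - 2 det ∇v`. The divergence vanishes, and the determinant
is itself a divergence whose boundary terms vanish because `v` is zero near the upper wall and has
no normal component on the lower one (`integral_det_eq_zero`). Hence `‖∇v‖² = 2‖Dv‖²`, of which
`MemSmooth.korn` keeps one direction.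

Poincaré and trace: for a component `a` that is zero on the upper wall, integrate `∂_y (q a²)` with
a weight `q(y)` and complete the square. If `q' - q² ≥ c`, this bounds `c ∫ a² + q(0) ∫_Γ a²` by `∫
(∂_y a)²` (`riccati_estimate`). A tangent weight gives `poincare_estimate`, a reciprocal weight
gives `trace_estimate`.

Together these make a `V_L`-Cauchy sequence of smooth fields Cauchy in `W^{1,2}` and on the wall, so
that it converges (`IsVCauchy.exists_limit`). For an arbitrary element `(u, g)` of `V_L` one
difficulty is left: approximation in the `V_L`-norm controls only `D(u - v n)`, so the `L²`-limit
`u'` of the smooth fields could differ from `u` by a field with zero symmetric gradient. Such a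
field in `L²` of the infinite strip is zero (`ae_eq_zero_of_isWeakSymGrad`), hence `u = u'`. All
bounds then follow by taking limits along the sequence of `MemV.exists_approximation`. -/

theorem MeasureTheory.MemLp.norm_toLp_sq {f : X → F} (hf : MemLp f 2 μ) :
    ‖hf.toLp f‖ ^ 2 = ∫ x, ‖f x‖ ^ 2 ∂μ := by
  rw [Lp.norm_toLp, hf.eLpNorm_eq_integral_rpow_norm two_ne_zero ENNReal.ofNat_ne_top,
    ENNReal.toReal_ofReal (by positivity), ← Real.rpow_natCast, ← Real.rpow_mul (by positivity)]
  simp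

theorem MeasureTheory.MemLp.integrable_norm_sq {f : X → F} (hf : MemLp f 2 μ) :
    Integrable (fun x => ‖f x‖ ^ 2) μ :=
  (memLp_two_iff_integrable_sq_norm hf.1).1 hf

theorem MeasureTheory.MemLp.norm_toLp_sub_sq {f g : X → F} (hf : MemLp f 2 μ) (hg : MemLp g 2 μ) :
    ‖hf.toLp f - hg.toLp g‖ ^ 2 = ∫ x, ‖f x - g x‖ ^ 2 ∂μ := by
  rw [← MemLp.toLp_sub, MemLp.norm_toLp_sq]
  rfl

/-- Completeness of `L²`, for sequences of functions. -/
theorem exists_memLp_tendsto_integral_sq [CompleteSpace F] {f : ℕ → X → F}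
    (hf : ∀ n, MemLp (f n) 2 μ)
    (hc : ∀ ε > 0, ∃ N, ∀ m ≥ N, ∀ n ≥ N, ∫ x, ‖f m x - f n x‖ ^ 2 ∂μ < ε) :
    ∃ g, MemLp g 2 μ ∧ Tendsto (fun n => ∫ x, ‖g x - f n x‖ ^ 2 ∂μ) atTop (𝓝 0) := by
  have hcs : CauchySeq (fun n => (hf n).toLp (f n)) := by
    rw [Metric.cauchySeq_iff]
    intro ε hε
    obtain ⟨N, hN⟩ := hc (ε ^ 2) (by positivity)
    refine ⟨N, fun m hm n hn => ?_⟩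
    rw [dist_eq_norm]
    refine lt_of_pow_lt_pow_left₀ 2 hε.le ?_
    rw [(hf m).norm_toLp_sub_sq (hf n)]
    exact hN m hm n hn
  obtain ⟨g, hg⟩ := cauchySeq_tendsto_of_complete hcs
  refine ⟨g, Lp.memLp g, ?_⟩
  have h1 := ((tendsto_iff_norm_sub_tendsto_zero.1 hg).pow 2)
  rw [zero_pow two_ne_zero] at h1
  refine h1.congr fun n => ?_
  rw [norm_sub_rev]
  conv_lhs => rw [← Lp.toLp_coeFn g (Lp.memLp g)]
  exact MemLp.norm_toLp_sub_sq _ _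

theorem tendsto_toLp_of_tendsto_integral_sq {f : ℕ → X → F} {g : X → F}
    (hf : ∀ n, MemLp (f n) 2 μ) (hg : MemLp g 2 μ)
    (h : Tendsto (fun n => ∫ x, ‖g x - f n x‖ ^ 2 ∂μ) atTop (𝓝 0)) :
    Tendsto (fun n => (hf n).toLp (f n)) atTop (𝓝 (hg.toLp g)) := by
  rw [tendsto_iff_norm_sub_tendsto_zero]
  have h1 := (Real.continuous_sqrt.tendsto 0).comp h
  rw [Real.sqrt_zero] at h1
  refine h1.congr fun n => ?_
  rw [Function.comp_apply, ← hg.norm_toLp_sub_sq (hf n), Real.sqrt_sq (norm_nonneg _),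
    norm_sub_rev]

theorem tendsto_integral_norm_sq {f : ℕ → X → F} {g : X → F}
    (hf : ∀ n, MemLp (f n) 2 μ) (hg : MemLp g 2 μ)
    (h : Tendsto (fun n => ∫ x, ‖g x - f n x‖ ^ 2 ∂μ) atTop (𝓝 0)) :
    Tendsto (fun n => ∫ x, ‖f n x‖ ^ 2 ∂μ) atTop (𝓝 (∫ x, ‖g x‖ ^ 2 ∂μ)) := by
  have h1 := ((tendsto_toLp_of_tendsto_integral_sq hf hg h).norm).pow 2
  simpa only [MemLp.norm_toLp_sq] using h1

/-- `‖f - h‖² ≤ 2 (‖g - f‖² + ‖g - h‖²)` in `L²`. -/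
theorem integral_norm_sub_sq_le {f g h : X → F} (hf : MemLp f 2 μ) (hg : MemLp g 2 μ)
    (hh : MemLp h 2 μ) :
    ∫ x, ‖f x - h x‖ ^ 2 ∂μ ≤
      2 * ((∫ x, ‖g x - f x‖ ^ 2 ∂μ) + ∫ x, ‖g x - h x‖ ^ 2 ∂μ) := by
  have i1 := (hg.sub hf).integrable_norm_sq
  have i2 := (hg.sub hh).integrable_norm_sq
  simp only [Pi.sub_apply] at i1 i2
  rw [← integral_add i1 i2, ← integral_const_mul]
  refine integral_mono (hf.sub hh).integrable_norm_sq ((i1.add i2).const_mul 2) fun x => ?_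
  have h1 : ‖f x - h x‖ ≤ ‖g x - f x‖ + ‖g x - h x‖ := by
    have := norm_sub_le (g x - h x) (g x - f x)
    rw [sub_sub_sub_cancel_left] at this
    linarith
  have h2 : ‖f x - h x‖ ^ 2 ≤ (‖g x - f x‖ + ‖g x - h x‖) ^ 2 := by gcongr
  nlinarith [sq_nonneg (‖g x - f x‖ - ‖g x - h x‖)]

/-- Two `L²`-limits of one sequence agree almost everywhere. -/
theorem ae_eq_of_tendsto_integral_sq {f : ℕ → X → F} {g h : X → F}
    (hf : ∀ n, MemLp (f n) 2 μ) (hg : MemLp g 2 μ) (hh : MemLp h 2 μ)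
    (h1 : Tendsto (fun n => ∫ x, ‖g x - f n x‖ ^ 2 ∂μ) atTop (𝓝 0))
    (h2 : Tendsto (fun n => ∫ x, ‖h x - f n x‖ ^ 2 ∂μ) atTop (𝓝 0)) : g =ᵐ[μ] h :=
  (MemLp.toLp_eq_toLp_iff hg hh).1 <|
    tendsto_nhds_unique (tendsto_toLp_of_tendsto_integral_sq hf hg h1)
      (tendsto_toLp_of_tendsto_integral_sq hf hh h2)

/-- The Cauchy–Schwarz inequality for the integral of a product. -/
theorem sq_integral_mul_le {f g : X → ℝ} (hf : MemLp f 2 μ) (hg : MemLp g 2 μ) :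
    (∫ x, f x * g x ∂μ) ^ 2 ≤ (∫ x, f x ^ 2 ∂μ) * ∫ x, g x ^ 2 ∂μ := by
  have h := real_inner_mul_inner_self_le (hf.toLp f) (hg.toLp g)
  have e : inner ℝ (hf.toLp f) (hg.toLp g) = ∫ x, f x * g x ∂μ := by
    rw [L2.inner_def]
    refine integral_congr_ae ?_
    filter_upwards [hf.coeFn_toLp, hg.coeFn_toLp] with x h1 h2
    rw [h1, h2]
    simp [mul_comm]
  rw [e, real_inner_self_eq_norm_sq, real_inner_self_eq_norm_sq, hf.norm_toLp_sq,
    hg.norm_toLp_sq] at h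
  simpa only [sq, Real.norm_eq_abs, abs_mul_abs_self] using h

variable {ι : Type*} [Fintype ι]

theorem MeasureTheory.MemLp.euclidean_apply {f : X → EuclideanSpace ℝ ι} {p : ENNReal}
    (hf : MemLp f p μ) (i : ι) : MemLp (fun x => f x i) p μ :=
  (EuclideanSpace.proj (𝕜 := ℝ) i).comp_memLp' hf

theorem MeasureTheory.MemLp.toEuclidean {f : X → ι → ℝ} {p : ENNReal}
    (hf : ∀ i, MemLp (fun x => f x i) p μ) :
    MemLp (fun x => (WithLp.toLp 2 (f x) : EuclideanSpace ℝ ι)) p μ :=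
  (PiLp.continuousLinearEquiv 2 ℝ (fun _ : ι => ℝ)).symm.toContinuousLinearMap.comp_memLp'
    (MemLp.of_eval hf)

/-- Components of an `L²`-convergent sequence may be tested against `L²` functions. -/
theorem tendsto_integral_apply_mul {f : ℕ → X → EuclideanSpace ℝ ι} {g : X → EuclideanSpace ℝ ι}
    {φ : X → ℝ} (hf : ∀ n, MemLp (f n) 2 μ) (hg : MemLp g 2 μ) (hφ : MemLp φ 2 μ)
    (h : Tendsto (fun n => ∫ x, ‖g x - f n x‖ ^ 2 ∂μ) atTop (𝓝 0)) (i : ι) :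
    Tendsto (fun n => ∫ x, f n x i * φ x ∂μ) atTop (𝓝 (∫ x, g x i * φ x ∂μ)) := by
  rw [tendsto_iff_norm_sub_tendsto_zero]
  have h1 : Tendsto (fun n => √((∫ x, ‖g x - f n x‖ ^ 2 ∂μ) * ∫ x, φ x ^ 2 ∂μ)) atTop (𝓝 0) := by
    simpa [Function.comp_def] using
      (Real.continuous_sqrt.tendsto _).comp (h.mul_const (∫ x, φ x ^ 2 ∂μ))
  refine squeeze_zero (fun _ => norm_nonneg _) (fun n => ?_) h1
  have i1 : Integrable (fun x => f n x i * φ x) μ := ((hf n).euclidean_apply i).integrable_mul hφ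
  have i2 : Integrable (fun x => g x i * φ x) μ := (hg.euclidean_apply i).integrable_mul hφ
  rw [← integral_sub i1 i2, Real.norm_eq_abs]
  refine Real.abs_le_sqrt ?_
  have hd := (hg.sub (hf n))
  have h2 := sq_integral_mul_le (hd.euclidean_apply i) hφ
  have e : (∫ x, (g - f n) x i * φ x ∂μ) = - ∫ x, f n x i * φ x - g x i * φ x ∂μ := by
    rw [← integral_neg]
    congr 1 with x
    simp only [Pi.sub_apply, PiLp.sub_apply]
    ring
  rw [e, neg_sq] at h2
  refine h2.trans (mul_le_mul_of_nonneg_right ?_ (integral_nonneg fun _ => sq_nonneg _))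
  refine integral_mono (hd.euclidean_apply i).integrable_sq hd.integrable_norm_sq fun x => ?_
  have h3 := PiLp.norm_apply_le ((g - f n) x) i
  rw [Real.norm_eq_abs] at h3
  calc _ = |(g - f n) x i| ^ 2 := (sq_abs _).symm
    _ ≤ _ := pow_le_pow_left₀ (abs_nonneg _) h3 2

end SquareIntegrable

namespace SlipChannel

/-! ### Weak derivatives in the channel -/

variable {L : ℝ}

theorem channel_eq_prod (L : ℝ) : channel L = Set.univ ×ˢ Set.Ioo 0 L := by
  ext p; simp [channel]

theorem isOpen_channel (L : ℝ) : IsOpen (channel L) := by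
  rw [channel_eq_prod]; exact isOpen_univ.prod isOpen_Ioo

theorem measurableSet_channel (L : ℝ) : MeasurableSet (channel L) :=
  (isOpen_channel L).measurableSet

theorem closure_channel (hL : 0 < L) : closure (channel L) = Set.univ ×ˢ Set.Icc 0 L := by
  rw [channel_eq_prod, closure_prod_eq, closure_univ, closure_Ioo hL.ne]

theorem IsTest.pderiv {φ : ℝ × ℝ → ℝ} (hφ : IsTest L φ) (j : Fin 2) : IsTest L (pderiv j φ) := by
  refine ⟨(hφ.1.fderiv_right (m := ∞) (by simp)).clm_apply contDiff_const, hφ.2.1.fderiv_apply ℝ _, ?_⟩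
  exact (tsupport_fderiv_apply_subset ℝ _).trans hφ.2.2

theorem IsTest.memLp {φ : ℝ × ℝ → ℝ} (hφ : IsTest L φ) (μ : Measure (ℝ × ℝ))
    [IsFiniteMeasureOnCompacts μ] (p : ENNReal) : MemLp φ p μ :=
  hφ.1.continuous.memLp_of_hasCompactSupport hφ.2.1

theorem IsTest.eq_zero {φ : ℝ × ℝ → ℝ} (hφ : IsTest L φ) {p : ℝ × ℝ} (hp : p ∉ channel L) :
    φ p = 0 :=
  image_eq_zero_of_notMem_tsupport fun h => hp (hφ.2.2 h)

/-- A locally integrable function times a test function is integrable. -/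
theorem IsTest.integrable_mul {φ f : ℝ × ℝ → ℝ} (hφ : IsTest L φ)
    (hf : LocallyIntegrableOn f (channel L)) :
    Integrable (fun p => f p * φ p) (volume.restrict (channel L)) := by
  have h1 : IntegrableOn (fun p => f p * φ p) (tsupport φ) :=
    (hf.integrableOn_compact_subset hφ.2.2 hφ.2.1).mul_continuousOn
      hφ.1.continuous.continuousOn hφ.2.1
  refine h1.of_forall_sdiff_eq_zero (measurableSet_channel L) fun p hp => ?_
  rw [image_eq_zero_of_notMem_tsupport hp.2, mul_zero]

theorem _root_.MeasureTheory.LocallyIntegrableOn.euclidean_apply {ι : Type*} [Fintype ι]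
    {f : ℝ × ℝ → EuclideanSpace ℝ ι} {s : Set (ℝ × ℝ)} (hf : LocallyIntegrableOn f s) (i : ι) :
    LocallyIntegrableOn (fun p => f p i) s := fun x hx => by
  obtain ⟨t, ht, hi⟩ := hf x hx
  exact ⟨t, ht, (EuclideanSpace.proj (𝕜 := ℝ) i).integrable_comp hi⟩

theorem MemL2.locallyIntegrableOn {F : Type*} [NormedAddCommGroup F] {f : ℝ × ℝ → F}
    (hf : MemL2 L f) : LocallyIntegrableOn f (channel L) :=
  fun x _ => by
    obtain ⟨t, ht, hi⟩ := (hf.locallyIntegrable one_le_two) x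
    refine ⟨channel L ∩ t, inter_mem_nhdsWithin _ ht, ?_⟩
    have := hi
    rw [IntegrableOn, Measure.restrict_restrict' (measurableSet_channel L)] at this
    rwa [Set.inter_comm]

theorem IsWeakGrad.isWeakSymGrad {u : ℝ × ℝ → Vel} {G : ℝ × ℝ → Mat2} (h : IsWeakGrad L u G)
    {S : ℝ × ℝ → Mat2} (hS : LocallyIntegrableOn S (channel L))
    (hSG : ∀ᵐ p ∂volume.restrict (channel L), ∀ i j, S p (i, j) = (G p (i, j) + G p (j, i)) / 2) :
    IsWeakSymGrad L u S := by
  refine ⟨h.1, hS, fun φ hφ i j => ?_⟩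
  have e1 : ∫ p in channel L, S p (i, j) * φ p =
      ∫ p in channel L, (G p (i, j) * φ p + G p (j, i) * φ p) / 2 := by
    refine integral_congr_ae ?_
    filter_upwards [hSG] with p hp
    rw [hp]; ring
  rw [e1, integral_div, integral_add (hφ.integrable_mul (h.2.1.euclidean_apply _))
    (hφ.integrable_mul (h.2.1.euclidean_apply _)), h.2.2 φ hφ i j, h.2.2 φ hφ j i, integral_div,
    integral_add ((hφ.pderiv j).integrable_mul (h.1.euclidean_apply _))
    ((hφ.pderiv i).integrable_mul (h.1.euclidean_apply _))]
  ring

theorem IsWeakGrad.sub {u v : ℝ × ℝ → Vel} {G H : ℝ × ℝ → Mat2} (hu : IsWeakGrad L u G)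
    (hv : IsWeakGrad L v H) : IsWeakGrad L (u - v) (G - H) := by
  refine ⟨hu.1.sub hv.1, hu.2.1.sub hv.2.1, fun φ hφ i j => ?_⟩
  simp only [Pi.sub_apply, PiLp.sub_apply, sub_mul]
  rw [integral_sub (hφ.integrable_mul (hu.2.1.euclidean_apply _))
    (hφ.integrable_mul (hv.2.1.euclidean_apply _)),
    integral_sub ((hφ.pderiv j).integrable_mul (hu.1.euclidean_apply _))
    ((hφ.pderiv j).integrable_mul (hv.1.euclidean_apply _)), hu.2.2 φ hφ i j, hv.2.2 φ hφ i j]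
  ring

theorem IsWeakSymGrad.sub {u v : ℝ × ℝ → Vel} {S T : ℝ × ℝ → Mat2} (hu : IsWeakSymGrad L u S)
    (hv : IsWeakSymGrad L v T) : IsWeakSymGrad L (u - v) (S - T) := by
  refine ⟨hu.1.sub hv.1, hu.2.1.sub hv.2.1, fun φ hφ i j => ?_⟩
  have iu : Integrable (fun p => (u p i * SlipChannel.pderiv j φ p +
      u p j * SlipChannel.pderiv i φ p) / 2) (volume.restrict (channel L)) :=
    (((hφ.pderiv j).integrable_mul (hu.1.euclidean_apply i)).add
      ((hφ.pderiv i).integrable_mul (hu.1.euclidean_apply j))).div_const 2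
  have iv : Integrable (fun p => (v p i * SlipChannel.pderiv j φ p +
      v p j * SlipChannel.pderiv i φ p) / 2) (volume.restrict (channel L)) :=
    (((hφ.pderiv j).integrable_mul (hv.1.euclidean_apply i)).add
      ((hφ.pderiv i).integrable_mul (hv.1.euclidean_apply j))).div_const 2
  have e : ∀ p, ((u - v) p i * SlipChannel.pderiv j φ p + (u - v) p j * SlipChannel.pderiv i φ p) / 2
      = (u p i * SlipChannel.pderiv j φ p + u p j * SlipChannel.pderiv i φ p) / 2 -
        (v p i * SlipChannel.pderiv j φ p + v p j * SlipChannel.pderiv i φ p) / 2 := fun p => by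
    simp only [Pi.sub_apply, PiLp.sub_apply]; ring
  simp only [e]
  rw [integral_sub iu iv]
  simp only [Pi.sub_apply, PiLp.sub_apply, sub_mul]
  rw [integral_sub (hφ.integrable_mul (hu.2.1.euclidean_apply _))
    (hφ.integrable_mul (hv.2.1.euclidean_apply _)), hu.2.2 φ hφ i j, hv.2.2 φ hφ i j]
  ring

/-- A locally integrable matrix field that integrates to zero against all test functions vanishes
almost everywhere. -/
theorem ae_eq_of_integral_mul_eq {G H : ℝ × ℝ → Mat2} (hG : LocallyIntegrableOn G (channel L))
    (hH : LocallyIntegrableOn H (channel L))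
    (h : ∀ φ, IsTest L φ → ∀ i j : Fin 2,
      ∫ p in channel L, G p (i, j) * φ p = ∫ p in channel L, H p (i, j) * φ p) :
    G =ᵐ[volume.restrict (channel L)] H := by
  have key : ∀ ij : Fin 2 × Fin 2, ∀ᵐ p, p ∈ channel L → (G - H) p ij = 0 := fun ij => by
    refine (isOpen_channel L).ae_eq_zero_of_integral_contDiff_smul_eq_zero
      ((hG.sub hH).euclidean_apply ij) fun φ h1 h2 h3 => ?_
    have hφ : IsTest L φ := ⟨h1, h2, h3⟩
    rw [← setIntegral_eq_integral_of_forall_compl_eq_zero (s := channel L)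
      fun p hp => by rw [hφ.eq_zero hp, zero_smul]]
    have := h φ hφ ij.1 ij.2
    rw [← sub_eq_zero, ← integral_sub (hφ.integrable_mul (hG.euclidean_apply _))
      (hφ.integrable_mul (hH.euclidean_apply _))] at this
    rw [← this]
    congr 1 with p
    simp only [Pi.sub_apply, PiLp.sub_apply, smul_eq_mul]
    ring
  rw [EventuallyEq, ae_restrict_iff' (measurableSet_channel L)]
  filter_upwards [ae_all_iff.2 key] with p hp hpL
  ext ij
  simpa [sub_eq_zero] using hp ij hpL

/-- The gradient in the norm is picked by choice. Uniqueness allows any concrete representative to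
replace it in integrals. -/
theorem weakGrad_ae_eq {u : ℝ × ℝ → Vel} {G : ℝ × ℝ → Mat2} (h : IsWeakGrad L u G) :
    weakGrad L u =ᵐ[volume.restrict (channel L)] G := by
  have hex : ∃ G, IsWeakGrad L u G := ⟨G, h⟩
  have hs : IsWeakGrad L u (weakGrad L u) := by
    rw [weakGrad, dif_pos hex]; exact hex.choose_spec
  exact ae_eq_of_integral_mul_eq hs.2.1 h.2.1 fun φ hφ i j => by
    rw [hs.2.2 φ hφ, h.2.2 φ hφ]

theorem weakSymGrad_ae_eq {u : ℝ × ℝ → Vel} {S : ℝ × ℝ → Mat2} (h : IsWeakSymGrad L u S) :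
    weakSymGrad L u =ᵐ[volume.restrict (channel L)] S := by
  have hex : ∃ S, IsWeakSymGrad L u S := ⟨S, h⟩
  have hs : IsWeakSymGrad L u (weakSymGrad L u) := by
    rw [weakSymGrad, dif_pos hex]; exact hex.choose_spec
  exact ae_eq_of_integral_mul_eq hs.2.1 h.2.1 fun φ hφ i j => by
    rw [hs.2.2 φ hφ, h.2.2 φ hφ]

theorem integral_weakGrad_sq {u : ℝ × ℝ → Vel} {G : ℝ × ℝ → Mat2} (h : IsWeakGrad L u G) :
    ∫ p in channel L, ‖weakGrad L u p‖ ^ 2 = ∫ p in channel L, ‖G p‖ ^ 2 :=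
  integral_congr_ae ((weakGrad_ae_eq h).mono fun p hp => by simp only [hp])

theorem integral_weakSymGrad_sq {u : ℝ × ℝ → Vel} {S : ℝ × ℝ → Mat2} (h : IsWeakSymGrad L u S) :
    ∫ p in channel L, ‖weakSymGrad L u p‖ ^ 2 = ∫ p in channel L, ‖S p‖ ^ 2 :=
  integral_congr_ae ((weakSymGrad_ae_eq h).mono fun p hp => by simp only [hp])

/-- Weak gradients pass to the limit in `L²`. -/
theorem IsWeakGrad.of_tendsto {v : ℕ → ℝ × ℝ → Vel} {G : ℕ → ℝ × ℝ → Mat2}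
    (h : ∀ n, IsWeakGrad L (v n) (G n)) (hv : ∀ n, MemL2 L (v n)) (hG : ∀ n, MemL2 L (G n))
    {u : ℝ × ℝ → Vel} {H : ℝ × ℝ → Mat2} (hu : MemL2 L u) (hH : MemL2 L H)
    (h1 : Tendsto (fun n => ∫ p in channel L, ‖u p - v n p‖ ^ 2) atTop (𝓝 0))
    (h2 : Tendsto (fun n => ∫ p in channel L, ‖H p - G n p‖ ^ 2) atTop (𝓝 0)) :
    IsWeakGrad L u H := by
  refine ⟨hu.locallyIntegrableOn, hH.locallyIntegrableOn, fun φ hφ i j => ?_⟩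
  have t1 := tendsto_integral_apply_mul hG hH (hφ.memLp _ 2) h2 (i, j)
  have t2 := (tendsto_integral_apply_mul hv hu ((hφ.pderiv j).memLp _ 2) h1 i).neg
  refine tendsto_nhds_unique t1 (t2.congr fun n => ?_)
  exact ((h n).2.2 φ hφ i j).symm

/-- The symmetric part of a matrix field. -/
noncomputable def symPart (G : ℝ × ℝ → Mat2) (p : ℝ × ℝ) : Mat2 :=
  WithLp.toLp 2 fun ij => (G p (ij.1, ij.2) + G p (ij.2, ij.1)) / 2

theorem MemL2.symPart {G : ℝ × ℝ → Mat2} (hG : MemL2 L G) : MemL2 L (symPart G) := by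
  refine MemLp.toEuclidean fun ij => ?_
  have := ((MemLp.euclidean_apply hG (ij.1, ij.2)).add
    (MemLp.euclidean_apply hG (ij.2, ij.1))).const_mul (1 / 2)
  refine this.congr_norm ?_ (ae_of_all _ fun p => ?_)
  · exact ((this.1.const_mul 1).congr (ae_of_all _ fun p => by simp; ring))
  · congr 1; simp; ring

theorem IsWeakGrad.symPart {u : ℝ × ℝ → Vel} {G : ℝ × ℝ → Mat2} (h : IsWeakGrad L u G)
    (hG : MemL2 L G) : IsWeakSymGrad L u (symPart G) :=
  h.isWeakSymGrad hG.symPart.locallyIntegrableOn (ae_of_all _ fun _ _ _ => rfl)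

theorem symPart_sub (G H : ℝ × ℝ → Mat2) : symPart (G - H) = symPart G - symPart H := by
  ext p ij
  simp [symPart]
  ring

theorem norm_sq_mat (A : Mat2) :
    ‖A‖ ^ 2 = A (0, 0) ^ 2 + A (0, 1) ^ 2 + A (1, 0) ^ 2 + A (1, 1) ^ 2 := by
  rw [EuclideanSpace.real_norm_sq_eq, Fintype.sum_prod_type]
  simp [Fin.sum_univ_two]
  ring

/-- Symmetrization is an orthogonal projection for the Frobenius norm; the two sides differ by half
the square of the difference of the off-diagonal entries. Through this bound, convergence of
gradients implies convergence of symmetric gradients. -/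
theorem norm_symPart_sq_le (G : ℝ × ℝ → Mat2) (p : ℝ × ℝ) : ‖symPart G p‖ ^ 2 ≤ ‖G p‖ ^ 2 := by
  rw [norm_sq_mat, norm_sq_mat]
  simp only [SlipChannel.symPart]
  nlinarith [sq_nonneg (G p (0, 1) - G p (1, 0))]

/-! ### Scalar functions that are smooth up to the boundary of the channel -/

variable {R : ℝ} {a b : ℝ × ℝ → ℝ}

theorem mem_closure_channel (hL : 0 < L) {p : ℝ × ℝ} :
    p ∈ closure (channel L) ↔ 0 ≤ p.2 ∧ p.2 ≤ L := by
  rw [closure_channel hL]; simp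

theorem uniqueDiffOn_closure_channel (hL : 0 < L) : UniqueDiffOn ℝ (closure (channel L)) := by
  rw [closure_channel hL]; exact uniqueDiffOn_univ.prod (uniqueDiffOn_Icc hL)

theorem closure_channel_mem_nhds {p : ℝ × ℝ} (hp : p ∈ channel L) :
    closure (channel L) ∈ 𝓝 p :=
  mem_of_superset ((isOpen_channel L).mem_nhds hp) subset_closure

/-- The partial derivatives of a function on the closed channel, one-sided at the walls. -/
noncomputable def closedDeriv (L : ℝ) (j : Fin 2) (a : ℝ × ℝ → ℝ) (p : ℝ × ℝ) : ℝ :=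
  fderivWithin ℝ a (closure (channel L)) p (dir j)

theorem closedDeriv_eq_pderiv (j : Fin 2) {p : ℝ × ℝ} (hp : p ∈ channel L) :
    closedDeriv L j a p = pderiv j a p := by
  rw [closedDeriv, fderivWithin_of_mem_nhds (closure_channel_mem_nhds hp), pderiv]

/-- Functions on the closed channel that vanish where `|x| ≥ R`. -/
def VanishesBeyond (L R : ℝ) (a : ℝ × ℝ → ℝ) : Prop :=
  ∀ p ∈ closure (channel L), R ≤ |p.1| → a p = 0

theorem VanishesBeyond.mul_left (ha : VanishesBeyond L R a) (f : ℝ × ℝ → ℝ) :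
    VanishesBeyond L R (fun p => f p * a p) := fun p hp h => by
  simp only [ha p hp h, mul_zero]

theorem VanishesBeyond.mul_right (ha : VanishesBeyond L R a) (f : ℝ × ℝ → ℝ) :
    VanishesBeyond L R (fun p => a p * f p) := fun p hp h => by
  simp only [ha p hp h, zero_mul]

theorem VanishesBeyond.eventuallyEq (ha : VanishesBeyond L R a) {p : ℝ × ℝ} (hp : R < |p.1|) :
    a =ᶠ[𝓝[closure (channel L)] p] fun _ => 0 := by
  have h : ∀ᶠ q : ℝ × ℝ in 𝓝 p, R < |q.1| :=
    (continuous_fst.abs.tendsto p).eventually (lt_mem_nhds hp)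
  filter_upwards [self_mem_nhdsWithin, mem_nhdsWithin_of_mem_nhds h] with q hq h1
  exact ha q hq h1.le

/-- The derivative is read off from a neighbourhood, which requires `|x| > R` strictly; enlarging
`R` by one secures this. -/
theorem VanishesBeyond.closedDeriv (ha : VanishesBeyond L R a) (j : Fin 2) :
    VanishesBeyond L (R + 1) (closedDeriv L j a) := fun p hp h => by
  have h1 : R < |p.1| := by linarith
  rw [SlipChannel.closedDeriv, (ha.eventuallyEq h1).fderivWithin_eq (ha p hp h1.le)]
  simp

theorem VanishesBeyond.integrableOn (hL : 0 < L) (hc : ContinuousOn a (closure (channel L)))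
    (ha : VanishesBeyond L R a) : IntegrableOn a (channel L) := by
  have hsub : Set.Icc (-R) R ×ˢ Set.Icc 0 L ⊆ closure (channel L) := by
    rw [closure_channel hL]; exact Set.prod_mono (Set.subset_univ _) subset_rfl
  have h1 : IntegrableOn a (Set.Icc (-R) R ×ˢ Set.Icc 0 L) :=
    (hc.mono hsub).integrableOn_compact (isCompact_Icc.prod isCompact_Icc)
  refine h1.of_forall_sdiff_eq_zero (measurableSet_channel L) fun p hp => ?_
  refine ha p (subset_closure hp.1) ?_
  by_contra hR
  push Not at hR
  exact hp.2 ⟨⟨(abs_lt.1 hR).1.le, (abs_lt.1 hR).2.le⟩, hp.1.1.le, hp.1.2.le⟩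

theorem VanishesBeyond.memL2 (hL : 0 < L) (hc : ContinuousOn a (closure (channel L)))
    (ha : VanishesBeyond L R a) : MemL2 L a := by
  refine (memLp_two_iff_integrable_sq ?_).2 ?_
  · exact (hc.mono subset_closure).aestronglyMeasurable (measurableSet_channel L)
  · exact VanishesBeyond.integrableOn hL (hc.pow 2)
      (R := R) fun p hp h => by rw [ha p hp h]; simp

theorem continuous_wall (hL : 0 < L) (hc : ContinuousOn a (closure (channel L))) :
    Continuous fun x : ℝ => a (x, 0) :=
  hc.comp_continuous (by fun_prop) fun x => (mem_closure_channel hL).2 ⟨le_rfl, hL.le⟩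

theorem VanishesBeyond.hasCompactSupport_wall (hL : 0 < L) (ha : VanishesBeyond L R a) :
    HasCompactSupport fun x : ℝ => a (x, 0) := by
  refine HasCompactSupport.intro (isCompact_Icc (a := -R) (b := R)) fun x hx => ?_
  refine ha _ ((mem_closure_channel hL).2 ⟨le_rfl, hL.le⟩) ?_
  by_contra hR
  push Not at hR
  exact hx ⟨(abs_lt.1 hR).1.le, (abs_lt.1 hR).2.le⟩

/-- The divergence theorem in the channel, for fields that vanish for large `|x|` and at the upper
wall. -/
theorem integral_divergence_channel (hL : 0 < L) {f g : ℝ × ℝ → ℝ}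
    (hf : ContinuousOn f (closure (channel L))) (hg : ContinuousOn g (closure (channel L)))
    (hdf : ∀ p ∈ channel L, DifferentiableAt ℝ f p) (hdg : ∀ p ∈ channel L, DifferentiableAt ℝ g p)
    (hfR : VanishesBeyond L R f) (hgR : VanishesBeyond L R g) (hgL : ∀ x, g (x, L) = 0)
    (hi : IntegrableOn (fun p => pderiv 0 f p + pderiv 1 g p) (channel L)) :
    ∫ p in channel L, (pderiv 0 f p + pderiv 1 g p) = -∫ x : ℝ, g (x, 0) := by
  -- This half-width exceeds `R` and is positive even if `R` is negative, so the box is a genuine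
  -- rectangle whose lateral sides lie where the field vanishes.
  set M := |R| + 1 with hM
  have hRM : R < M := by linarith [le_abs_self R]
  have hM0 : 0 < M := by positivity
  set U : Set (ℝ × ℝ) := Set.Ioo (-M) M ×ˢ Set.Ioo 0 L with hU
  have hUL : U ⊆ channel L := fun p hp => hp.2
  have hae : (Set.Icc ((-M, 0) : ℝ × ℝ) (M, L) : Set (ℝ × ℝ)) =ᵐ[volume] U := by
    rw [← Set.Icc_prod_Icc]
    exact Measure.set_prod_ae_eq Ioo_ae_eq_Icc.symm Ioo_ae_eq_Icc.symm
  have hsub : Set.Icc ((-M, 0) : ℝ × ℝ) (M, L) ⊆ closure (channel L) := fun p hp =>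
    (mem_closure_channel hL).2 ⟨hp.1.2, hp.2.2⟩
  have hvan : ∀ p ∈ channel L \ U, pderiv 0 f p + pderiv 1 g p = 0 := fun p hp => by
    have h1 : R < |p.1| := by
      by_contra h
      have := abs_lt.1 (lt_of_le_of_lt (not_lt.1 h) hRM)
      exact hp.2 ⟨this, hp.1⟩
    rw [← closedDeriv_eq_pderiv 0 hp.1, ← closedDeriv_eq_pderiv 1 hp.1, closedDeriv, closedDeriv,
      (hfR.eventuallyEq h1).fderivWithin_eq (hfR p (subset_closure hp.1) h1.le),
      (hgR.eventuallyEq h1).fderivWithin_eq (hgR p (subset_closure hp.1) h1.le)]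
    simp
  have key := integral_divergence_prod_Icc_of_hasFDerivAt_of_le f g (fderiv ℝ f) (fderiv ℝ g)
    (-M, 0) (M, L) ⟨by simp; linarith, hL.le⟩ (hf.mono hsub) (hg.mono hsub)
    (fun p hp => (hdf p (hUL hp)).hasFDerivAt) (fun p hp => (hdg p (hUL hp)).hasFDerivAt)
    ((hi.mono_set hUL).congr_set_ae hae)
  have e1 : ∀ y ∈ Set.uIcc 0 L, f (M, y) = 0 ∧ f (-M, y) = 0 := fun y hy => by
    rw [Set.uIcc_of_le hL.le] at hy
    constructor <;> refine hfR _ ((mem_closure_channel hL).2 hy) ?_ <;>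
      simp [abs_of_pos hM0, hRM.le]
  simp only at key
  rw [intervalIntegral.integral_congr (g := fun _ => 0) (fun y hy => (e1 y hy).1),
    intervalIntegral.integral_congr (a := 0) (g := fun _ => 0) (fun y hy => (e1 y hy).2),
    intervalIntegral.integral_congr (g := fun _ => 0) (fun x _ => hgL x)] at key
  simp only [intervalIntegral.integral_zero, zero_sub, add_zero, sub_zero] at key
  -- Only the lower wall is left. Since `g` vanishes beyond `R < M`, its integral over the bottom
  -- side is the integral over the whole line.
  rw [intervalIntegral.integral_eq_integral_of_support_subset] at key
  · rw [← key, setIntegral_congr_set hae]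
    exact (setIntegral_eq_of_subset_of_forall_sdiff_eq_zero (measurableSet_channel L) hUL hvan)
  · intro x hx
    by_contra h
    refine hx (hgR (x, 0) ((mem_closure_channel hL).2 ⟨le_rfl, hL.le⟩) ?_)
    simp only
    by_contra hR
    have := abs_lt.1 (lt_trans (not_le.1 hR) hRM)
    exact h ⟨this.1, this.2.le⟩

theorem differentiableAt_of_mem_channel (ha : ContDiffOn ℝ ∞ a (closure (channel L)))
    {p : ℝ × ℝ} (hp : p ∈ channel L) : DifferentiableAt ℝ a p :=
  (ha.contDiffAt (closure_channel_mem_nhds hp)).differentiableAt (by simp)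

theorem contDiffOn_closedDeriv (hL : 0 < L) (ha : ContDiffOn ℝ ∞ a (closure (channel L)))
    (j : Fin 2) : ContDiffOn ℝ ∞ (closedDeriv L j a) (closure (channel L)) :=
  (ha.fderivWithin (uniqueDiffOn_closure_channel hL) (by simp)).clm_apply contDiffOn_const

/-- A weighted identity for `∂_y (q a²)`, estimated by Young's inequality: `q` is a subsolution of
a Riccati equation. -/
theorem riccati_estimate (hL : 0 < L) (ha : ContDiffOn ℝ ∞ a (closure (channel L)))
    (haR : VanishesBeyond L R a) (haL : ∀ x, a (x, L) = 0) {q q' : ℝ → ℝ} {c : ℝ}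
    (hq : ∀ y ∈ Set.Icc 0 L, HasDerivAt q (q' y) y) (hq' : ContinuousOn q' (Set.Icc 0 L))
    (hc : ∀ y ∈ Set.Icc 0 L, c ≤ q' y - q y ^ 2) :
    c * (∫ p in channel L, a p ^ 2) + q 0 * ∫ x : ℝ, a (x, 0) ^ 2 ≤
      ∫ p in channel L, closedDeriv L 1 a p ^ 2 := by
  have hmaps : Set.MapsTo Prod.snd (closure (channel L)) (Set.Icc 0 L) := fun p hp =>
    (mem_closure_channel hL).1 hp
  have cq : ContinuousOn (fun p : ℝ × ℝ => q p.2) (closure (channel L)) :=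
    ContinuousOn.comp (fun y hy => (hq y hy).continuousAt.continuousWithinAt)
      continuous_snd.continuousOn hmaps
  have cq' : ContinuousOn (fun p : ℝ × ℝ => q' p.2) (closure (channel L)) :=
    hq'.comp continuous_snd.continuousOn hmaps
  have ca := ha.continuousOn
  have cd := (contDiffOn_closedDeriv hL ha 1).continuousOn
  have hder : ∀ p ∈ channel L, HasFDerivAt (fun p : ℝ × ℝ => q p.2 * (a p * a p))
      (q p.2 • (a p • fderiv ℝ a p + a p • fderiv ℝ a p) +
        (a p * a p) • (q' p.2 • ContinuousLinearMap.snd ℝ ℝ ℝ)) p := fun p hp => by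
    have h1 : HasFDerivAt (fun p : ℝ × ℝ => q p.2) (q' p.2 • ContinuousLinearMap.snd ℝ ℝ ℝ) p :=
      (hq p.2 ⟨hp.1.le, hp.2.le⟩).comp_hasFDerivAt p hasFDerivAt_snd
    have h2 := (differentiableAt_of_mem_channel ha hp).hasFDerivAt
    exact h1.mul (h2.mul h2)
  have hpd : ∀ p ∈ channel L, pderiv 0 (fun _ => (0 : ℝ)) p +
      pderiv 1 (fun p : ℝ × ℝ => q p.2 * (a p * a p)) p =
      q' p.2 * a p ^ 2 + 2 * q p.2 * a p * closedDeriv L 1 a p := fun p hp => by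
    rw [closedDeriv_eq_pderiv 1 hp, pderiv, pderiv, pderiv, (hder p hp).fderiv]
    simp [dir]
    ring
  have i1 : IntegrableOn (fun p => q' p.2 * a p ^ 2 + 2 * q p.2 * a p * closedDeriv L 1 a p)
      (channel L) :=
    VanishesBeyond.integrableOn (R := R) hL
      ((cq'.mul (ca.pow 2)).add (((continuousOn_const.mul cq).mul ca).mul cd))
      fun p hp h => by simp [haR p hp h]
  have i2 : IntegrableOn (fun p => a p ^ 2) (channel L) :=
    VanishesBeyond.integrableOn (R := R) hL (ca.pow 2) fun p hp h => by simp [haR p hp h]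
  have i3 : IntegrableOn (fun p => closedDeriv L 1 a p ^ 2) (channel L) :=
    VanishesBeyond.integrableOn (R := R + 1) hL (cd.pow 2)
      fun p hp h => by simp [haR.closedDeriv 1 p hp h]
  -- With zero first component the divergence is `∂_y (q a²)`, and the only boundary term is `-q(0)
  -- ∫ a(x, 0)²`.
  have hdiv := integral_divergence_channel (R := R) hL (f := fun _ => 0)
    (g := fun p => q p.2 * (a p * a p)) continuousOn_const (cq.mul (ca.mul ca))
    (fun _ _ => differentiableAt_const _) (fun p hp => (hder p hp).differentiableAt)
    (fun _ _ _ => rfl) ((haR.mul_left a).mul_left _) (fun x => by simp [haL])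
    (i1.congr_fun (fun p hp => (hpd p hp).symm) (measurableSet_channel L))
  rw [setIntegral_congr_fun (measurableSet_channel L) hpd] at hdiv
  simp only [integral_const_mul] at hdiv
  have e : ∫ x : ℝ, a (x, 0) * a (x, 0) = ∫ x : ℝ, a (x, 0) ^ 2 := by simp only [sq]
  simp only [e] at hdiv
  -- Completing the square, `q' a² + 2 q a ∂_y a + (∂_y a)² = (∂_y a + q a)² + (q' - q²) a²`.
  have hmono : ∫ p in channel L, c * a p ^ 2 ≤ ∫ p in channel L,
      ((q' p.2 * a p ^ 2 + 2 * q p.2 * a p * closedDeriv L 1 a p) + closedDeriv L 1 a p ^ 2) := by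
    refine setIntegral_mono_on (i2.const_mul c) (i1.add i3) (measurableSet_channel L) fun p hp => ?_
    have h1 := mul_le_mul_of_nonneg_right (hc p.2 ⟨hp.1.le, hp.2.le⟩) (sq_nonneg (a p))
    nlinarith [sq_nonneg (closedDeriv L 1 a p + q p.2 * a p)]
  rw [integral_const_mul, integral_add i1 i3, hdiv] at hmono
  linarith

/-- A Poincaré inequality for functions that vanish at the upper wall. -/
theorem poincare_estimate (hL : 0 < L) (ha : ContDiffOn ℝ ∞ a (closure (channel L)))
    (haR : VanishesBeyond L R a) (haL : ∀ x, a (x, L) = 0) :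
    ∫ p in channel L, a p ^ 2 ≤
      16 * L ^ 2 / Real.pi ^ 2 * ∫ p in channel L, closedDeriv L 1 a p ^ 2 := by
  -- The weight `κ tan (κ y)` solves `q' - q² = κ²` with `q 0 = 0`. The sharp frequency `π / (2L)`
  -- would make it blow up at `y = L`; half of it keeps `κ y ≤ π / 4` and costs a factor 4 in the
  -- constant.
  set κ := Real.pi / (4 * L) with hκ
  have hπ := Real.pi_pos
  have hκ0 : 0 < κ := by positivity
  have hcos : ∀ y ∈ Set.Icc 0 L, 0 < Real.cos (κ * y) := fun y hy => by
    have h1 : κ * y ≤ Real.pi / 4 := by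
      calc κ * y ≤ κ * L := by gcongr; exact hy.2
        _ = Real.pi / 4 := by rw [hκ]; field_simp
    exact Real.cos_pos_of_mem_Ioo ⟨by nlinarith [hy.1], by linarith⟩
  have h := riccati_estimate hL ha haR haL (q := fun y => κ * Real.tan (κ * y))
    (q' := fun y => κ * (1 / Real.cos (κ * y) ^ 2 * κ)) (c := κ ^ 2) ?_ ?_ ?_
  · simp only [mul_zero, Real.tan_zero, zero_mul, add_zero] at h
    calc _ = 16 * L ^ 2 / Real.pi ^ 2 * (κ ^ 2 * ∫ p in channel L, a p ^ 2) := by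
          rw [hκ]; field_simp; norm_num
      _ ≤ _ := by gcongr
  · intro y hy
    have h1 := (Real.hasDerivAt_tan (hcos y hy).ne').comp y ((hasDerivAt_id y).const_mul κ)
    simp only [mul_one] at h1
    exact h1.const_mul κ
  · refine continuousOn_const.mul ((continuousOn_const.div (by fun_prop) fun y hy => ?_).mul
      continuousOn_const)
    exact pow_ne_zero _ (hcos y hy).ne'
  · intro y hy
    have h1 := (hcos y hy).ne'
    have h2 := Real.sin_sq_add_cos_sq (κ * y)
    rw [Real.tan_eq_sin_div_cos]
    refine le_of_eq ?_
    field_simp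
    linear_combination h2

/-- A trace inequality for functions that vanish at the upper wall. -/
theorem trace_estimate (hL : 0 < L) (ha : ContDiffOn ℝ ∞ a (closure (channel L)))
    (haR : VanishesBeyond L R a) (haL : ∀ x, a (x, L) = 0) :
    ∫ x : ℝ, a (x, 0) ^ 2 ≤ 2 * L * ∫ p in channel L, closedDeriv L 1 a p ^ 2 := by
  have hne : ∀ y ∈ Set.Icc 0 L, 2 * L - y ≠ 0 := fun y hy => by linarith [hy.2]
  -- This weight solves `q' = q²`, so the interior term drops out and `q 0 = 1 / (2L)` gives the
  -- constant. The pole at `2L` lies outside the channel.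
  have h := riccati_estimate hL ha haR haL (q := fun y => (2 * L - y)⁻¹)
    (q' := fun y => -(-1) / (2 * L - y) ^ 2) (c := 0) ?_ ?_ ?_
  · simp only [zero_mul, zero_add, sub_zero] at h
    calc _ = 2 * L * ((2 * L)⁻¹ * ∫ x : ℝ, a (x, 0) ^ 2) := by field_simp
      _ ≤ _ := by gcongr
  · intro y hy
    exact ((hasDerivAt_id y).const_sub (2 * L)).inv (hne y hy)
  · exact continuousOn_const.div (by fun_prop) fun y hy => pow_ne_zero _ (hne y hy)
  · intro y hy
    have := hne y hy
    refine le_of_eq ?_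
    field_simp
    ring

theorem pderiv_closedDeriv_comm (hb : ContDiffOn ℝ ∞ b (closure (channel L)))
    {p : ℝ × ℝ} (hp : p ∈ channel L) (i j : Fin 2) :
    pderiv i (closedDeriv L j b) p = pderiv j (closedDeriv L i b) p := by
  have hb' := hb.contDiffAt (closure_channel_mem_nhds hp)
  have key : ∀ i j : Fin 2, pderiv i (closedDeriv L j b) p =
      fderiv ℝ (fderiv ℝ b) p (dir i) (dir j) := fun i j => by
    have h1 : closedDeriv L j b =ᶠ[𝓝 p] fun q => fderiv ℝ b q (dir j) := by
      filter_upwards [(isOpen_channel L).mem_nhds hp] with q hq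
      exact closedDeriv_eq_pderiv j hq
    have h2 : DifferentiableAt ℝ (fderiv ℝ b) p :=
      (hb'.fderiv_right (m := ∞) (by simp)).differentiableAt (by simp)
    rw [pderiv, h1.fderiv_eq, fderiv_clm_apply h2 (differentiableAt_const _)]
    simp
  rw [key, key]
  exact hb'.isSymmSndFDerivAt (by
    rw [minSmoothness_of_isRCLikeNormedField]; exact WithTop.coe_le_coe.2 (le_top (a := (2 : ℕ∞)))) _ _

/-- The wall is a line contained in the closed channel, so the chain rule along it applies to the
derivative within that set. This is what removes the wall term of the null Lagrangian. -/
theorem closedDeriv_zero_wall (hL : 0 < L) (hb : ContDiffOn ℝ ∞ b (closure (channel L)))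
    (hb0 : ∀ x, b (x, 0) = 0) (x : ℝ) : closedDeriv L 0 b (x, 0) = 0 := by
  have hmem : ∀ x : ℝ, (x, (0 : ℝ)) ∈ closure (channel L) := fun x =>
    (mem_closure_channel hL).2 ⟨le_rfl, hL.le⟩
  have h1 := (hb.differentiableOn (by simp) (x, 0) (hmem x)).hasFDerivWithinAt
  have h2 : HasDerivAt (fun t : ℝ => (t, (0 : ℝ))) (1, 0) x :=
    (hasDerivAt_id x).prodMk (hasDerivAt_const x 0)
  have h3 := h1.comp_hasDerivAt x h2 (Eventually.of_forall hmem)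
  have h4 : b ∘ (fun t : ℝ => (t, (0 : ℝ))) = fun _ => 0 := funext hb0
  rw [h4] at h3
  have := h3.unique (hasDerivAt_const x 0)
  simpa [closedDeriv, dir] using this

/-- The Jacobian determinant is a null Lagrangian. -/
theorem integral_det_eq_zero (hL : 0 < L) (ha : ContDiffOn ℝ ∞ a (closure (channel L)))
    (hb : ContDiffOn ℝ ∞ b (closure (channel L))) (haR : VanishesBeyond L R a)
    (haL : ∀ x, a (x, L) = 0) (hb0 : ∀ x, b (x, 0) = 0) :
    ∫ p in channel L, (closedDeriv L 0 a p * closedDeriv L 1 b p -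
      closedDeriv L 1 a p * closedDeriv L 0 b p) = 0 := by
  have ca := ha.continuousOn
  have sb := fun j => contDiffOn_closedDeriv hL hb j
  have sa := fun j => contDiffOn_closedDeriv hL ha j
  have hd : ∀ j, ∀ p ∈ channel L, HasFDerivAt (fun p => a p * closedDeriv L j b p)
      (a p • fderiv ℝ (closedDeriv L j b) p + closedDeriv L j b p • fderiv ℝ a p) p :=
    fun j p hp => (differentiableAt_of_mem_channel ha hp).hasFDerivAt.mul
      (differentiableAt_of_mem_channel (sb j) hp).hasFDerivAt
  -- The determinant is `∂_x (a ∂_y b) - ∂_y (a ∂_x b)`, since the mixed second derivatives of `b`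
  -- cancel.
  have hpd : ∀ p ∈ channel L, pderiv 0 (fun p => a p * closedDeriv L 1 b p) p +
      pderiv 1 (fun p => -(a p * closedDeriv L 0 b p)) p =
      closedDeriv L 0 a p * closedDeriv L 1 b p - closedDeriv L 1 a p * closedDeriv L 0 b p :=
    fun p hp => by
    have h1 := pderiv_closedDeriv_comm hb hp 0 1
    rw [pderiv, (hd 1 p hp).fderiv, pderiv, (hd 0 p hp).fun_neg.fderiv,
      closedDeriv_eq_pderiv (a := a) 0 hp, closedDeriv_eq_pderiv (a := a) 1 hp]
    simp only [pderiv] at h1 ⊢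
    simp only [add_apply, neg_apply, smul_apply, smul_eq_mul]
    rw [h1]
    ring
  have i1 : IntegrableOn (fun p => closedDeriv L 0 a p * closedDeriv L 1 b p -
      closedDeriv L 1 a p * closedDeriv L 0 b p) (channel L) :=
    VanishesBeyond.integrableOn (R := R + 1) hL
      (((sa 0).continuousOn.mul (sb 1).continuousOn).sub
        ((sa 1).continuousOn.mul (sb 0).continuousOn))
      fun p hp h => by simp [haR.closedDeriv _ p hp h]
  have hdiv := integral_divergence_channel (R := R) hL (ca.mul (sb 1).continuousOn)
    (ca.mul (sb 0).continuousOn).neg (fun p hp => (hd 1 p hp).differentiableAt)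
    (fun p hp => (hd 0 p hp).fun_neg.differentiableAt) (haR.mul_right _)
    (fun p hp h => by simp [haR p hp h]) (fun x => by simp [haL])
    (i1.congr_fun (fun p hp => (hpd p hp).symm) (measurableSet_channel L))
  have e : ∫ p in channel L, _ = _ := setIntegral_congr_fun (measurableSet_channel L) hpd
  refine e.symm.trans (hdiv.trans ?_)
  simp [closedDeriv_zero_wall hL hb hb0]

/-! ### A square-integrable field with vanishing weak symmetric gradient vanishes -/

theorem sub_mem_channel {p : ℝ × ℝ} {T : ℝ} : p - (T, 0) ∈ channel L ↔ p ∈ channel L := by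
  simp [channel]

theorem IsTest.translate {ψ : ℝ × ℝ → ℝ} (hψ : IsTest L ψ) (T : ℝ) :
    IsTest L fun p => ψ (p - (T, 0)) := by
  refine ⟨hψ.1.comp (contDiff_id.sub contDiff_const),
    hψ.2.1.comp_homeomorph (Homeomorph.subRight ((T, 0) : ℝ × ℝ)), fun p hp => ?_⟩
  have h1 := tsupport_comp_subset_preimage ψ (f := fun p : ℝ × ℝ => p - (T, 0)) (by fun_prop) hp
  exact sub_mem_channel.1 (hψ.2.2 h1)

theorem pderiv_translate (ψ : ℝ × ℝ → ℝ) (T : ℝ) (j : Fin 2) (p : ℝ × ℝ) :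
    pderiv j (fun p => ψ (p - (T, 0))) p = pderiv j ψ (p - (T, 0)) := by
  rw [pderiv, fderiv_comp_sub, pderiv]

theorem IsTest.exists_bound {ψ : ℝ × ℝ → ℝ} (hψ : IsTest L ψ) :
    ∃ C R : ℝ, 0 ≤ C ∧ (∀ p, |ψ p| ≤ C) ∧ ∀ p, ψ p ≠ 0 → p ∈ Metric.closedBall 0 R := by
  obtain ⟨C, hC⟩ := hψ.2.1.exists_bound_of_continuous hψ.1.continuous
  obtain ⟨R, hR⟩ := hψ.2.1.isBounded.subset_closedBall 0
  exact ⟨C, R, (norm_nonneg _).trans (hC 0), hC, fun p hp => hR (subset_tsupport _ hp)⟩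

/-- If the weak derivative of `a` along the channel vanishes, integrals against the translates of a
test function do not depend on the translation. -/
theorem integral_mul_translate_eq {a ψ : ℝ × ℝ → ℝ} (ha : MemL2 L a)
    (h : ∀ φ, IsTest L φ → ∫ p in channel L, a p * pderiv 0 φ p = 0) (hψ : IsTest L ψ) (T : ℝ) :
    ∫ p in channel L, a p * ψ (p - (T, 0)) = ∫ p in channel L, a p * ψ p := by
  set F : ℝ → ℝ := fun T => ∫ p in channel L, a p * ψ (p - (T, 0)) with hF
  have hder : ∀ T, HasDerivAt F 0 T := fun T => by
    obtain ⟨C, R, hC0, hC, hR⟩ := (hψ.pderiv 0).exists_bound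
    -- For `|S - T| < 1` the derivatives of all translates are supported in this ball. The
    -- restriction matters: `a` is only locally integrable, so `C |a|` alone need not be an
    -- integrable bound.
    set K : Set (ℝ × ℝ) := Metric.closedBall (T, 0) (R + 1) with hK
    have hi : Integrable (K.indicator fun p => C * |a p|) (volume.restrict (channel L)) := by
      rw [integrable_indicator_iff Metric.isClosed_closedBall.measurableSet]
      exact (((ha.locallyIntegrable one_le_two).integrableOn_isCompact
        (isCompact_closedBall _ _)).norm).const_mul C
    have key := hasDerivAt_integral_of_dominated_loc_of_deriv_le (x₀ := T)
      (μ := volume.restrict (channel L)) (F := fun T p => a p * ψ (p - (T, 0)))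
      (F' := fun T p => a p * -pderiv 0 ψ (p - (T, 0))) (bound := K.indicator fun p => C * |a p|)
      (Metric.ball_mem_nhds T one_pos) ?_ ?_ ?_ ?_ hi ?_
    · have h0 : ∫ p in channel L, a p * -pderiv 0 ψ (p - (T, 0)) = 0 := by
        have := h _ (hψ.translate T)
        simp only [pderiv_translate] at this
        simp only [mul_neg, integral_neg, this, neg_zero]
      rw [h0] at key
      exact key.2
    · exact Eventually.of_forall fun T =>
        ((hψ.translate T).integrable_mul ha.locallyIntegrableOn).1
    · exact (hψ.translate T).integrable_mul ha.locallyIntegrableOn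
    · have := (((hψ.pderiv 0).translate T).integrable_mul ha.locallyIntegrableOn).neg
      exact this.1.congr (ae_of_all _ fun p => by simp)
    · refine ae_of_all _ fun p S hS => ?_
      by_cases hp : pderiv 0 ψ (p - (S, 0)) = 0
      · rw [hp]
        simpa using Set.indicator_nonneg (fun p _ => by positivity) p
      · have hpK : p ∈ K := by
          have h1 := hR _ hp
          rw [hK, Metric.mem_closedBall]
          rw [Metric.mem_closedBall, dist_zero_right] at h1
          have h2 : dist ((S, 0) : ℝ × ℝ) (T, 0) < 1 := by
            simpa [Prod.dist_eq] using hS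
          have h3 := dist_triangle p (S, 0) (T, 0)
          rw [dist_eq_norm p (S, 0)] at h3
          linarith
        rw [Set.indicator_of_mem hpK, norm_mul, norm_neg, mul_comm]
        exact mul_le_mul_of_nonneg_right (hC _) (abs_nonneg _)
    · refine ae_of_all _ fun p S _ => ?_
      have h1 : HasDerivAt (fun S : ℝ => p - (S, (0 : ℝ))) (-(1, 0)) S :=
        ((hasDerivAt_id S).prodMk (hasDerivAt_const S 0)).const_sub p
      have h2 := ((hψ.1.differentiable (by simp) (p - (S, 0))).hasFDerivAt).comp_hasDerivAt S h1
      rw [map_neg] at h2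
      exact h2.const_mul (a p)
  have := is_const_of_deriv_eq_zero (fun T => (hder T).differentiableAt)
    (fun T => (hder T).deriv) T 0
  simpa only [hF, Prod.mk_zero_zero, sub_zero] using this

/-- Slide the test function to infinity along the strip. The pairing with `a` does not change, while
by Cauchy–Schwarz it is bounded by the `L²` mass of `a` in a half-strip that recedes to infinity,
and this mass tends to zero. -/
theorem ae_eq_zero_of_integral_mul_pderiv {a : ℝ × ℝ → ℝ} (ha : MemL2 L a)
    (h : ∀ φ, IsTest L φ → ∫ p in channel L, a p * pderiv 0 φ p = 0) :
    a =ᵐ[volume.restrict (channel L)] 0 := by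
  have key : ∀ ψ, IsTest L ψ → ∫ p in channel L, a p * ψ p = 0 := fun ψ hψ => by
    obtain ⟨C, R, -, -, hR⟩ := hψ.exists_bound
    set A : ℕ → Set (ℝ × ℝ) := fun n => {p | (n : ℝ) - R ≤ p.1} with hA
    have hAm : ∀ n, MeasurableSet (A n) := fun n =>
      measurableSet_le measurable_const measurable_fst
    have hle : ∀ n : ℕ, (∫ p in channel L, a p * ψ p) ^ 2 ≤
        (∫ p in channel L, (A n).indicator a p ^ 2) * ∫ p in channel L, ψ p ^ 2 := fun n => by
      have e1 : ∫ p in channel L, a p * ψ p =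
          ∫ p in channel L, (A n).indicator a p * ψ (p - ((n : ℝ), 0)) := by
        rw [← integral_mul_translate_eq ha h hψ n]
        congr 1 with p
        by_cases hp : ψ (p - ((n : ℝ), 0)) = 0
        · rw [hp, mul_zero, mul_zero]
        · have h1 := hR _ hp
          rw [Metric.mem_closedBall, dist_zero_right] at h1
          have h2 := (norm_fst_le _).trans h1
          have h3 : p ∈ A n := by
            have := (abs_le.1 h2).1
            simp only [Prod.fst_sub] at this
            simp only [hA, Set.mem_ofPred_eq]
            linarith
          rw [Set.indicator_of_mem h3]
      have e2 : ∫ p in channel L, ψ p ^ 2 = ∫ p in channel L, ψ (p - ((n : ℝ), 0)) ^ 2 := by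
        rw [setIntegral_eq_integral_of_forall_compl_eq_zero fun p hp => by simp [hψ.eq_zero hp],
          setIntegral_eq_integral_of_forall_compl_eq_zero fun p hp => by
            simp [(hψ.translate n).eq_zero hp],
          integral_sub_right_eq_self (fun p => ψ p ^ 2)]
      rw [e1, e2]
      exact sq_integral_mul_le (ha.indicator (hAm n)) ((hψ.translate n).memLp _ 2)
    have hlim : Tendsto (fun n => ∫ p in channel L, (A n).indicator a p ^ 2) atTop (𝓝 0) := by
      have := tendsto_integral_of_dominated_convergence (μ := volume.restrict (channel L))
        (F := fun n p => (A n).indicator a p ^ 2) (f := fun _ => 0) (fun p => a p ^ 2)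
        (fun n => (ha.indicator (hAm n)).1.pow 2) ha.integrable_sq
        (fun n => ae_of_all _ fun p => ?_) (ae_of_all _ fun p => ?_)
      · simpa using this
      · rw [Real.norm_eq_abs, abs_of_nonneg (sq_nonneg _)]
        by_cases hp : p ∈ A n
        · rw [Set.indicator_of_mem hp]
        · rw [Set.indicator_of_notMem hp]; simpa using sq_nonneg (a p)
      · refine tendsto_const_nhds.congr' ?_
        obtain ⟨N, hN⟩ := exists_nat_gt (p.1 + R)
        filter_upwards [eventually_ge_atTop N] with n hn
        have : (N : ℝ) ≤ n := by exact_mod_cast hn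
        rw [Set.indicator_of_notMem (by simp only [hA, Set.mem_ofPred_eq]; linarith)]
        simp
    have h2 := ge_of_tendsto' (hlim.mul_const (∫ p in channel L, ψ p ^ 2)) hle
    rw [zero_mul] at h2
    exact pow_eq_zero_iff two_ne_zero |>.1 (le_antisymm h2 (sq_nonneg _))
  have := (isOpen_channel L).ae_eq_zero_of_integral_contDiff_smul_eq_zero (μ := volume)
    ha.locallyIntegrableOn fun φ h1 h2 h3 => by
      have hφ : IsTest L φ := ⟨h1, h2, h3⟩
      rw [← setIntegral_eq_integral_of_forall_compl_eq_zero (s := channel L)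
        fun p hp => by rw [hφ.eq_zero hp, zero_smul], ← key φ hφ]
      simp only [smul_eq_mul, mul_comm]
  rwa [EventuallyEq, ae_restrict_iff' (measurableSet_channel L)]

/-- There are no square-integrable rigid motions of the channel. -/
theorem ae_eq_zero_of_isWeakSymGrad {w : ℝ × ℝ → Vel} {S : ℝ × ℝ → Mat2} (hw : MemL2 L w)
    (h : IsWeakSymGrad L w S) (hS : S =ᵐ[volume.restrict (channel L)] 0) :
    w =ᵐ[volume.restrict (channel L)] 0 := by
  have hz : ∀ φ, IsTest L φ → ∀ i j : Fin 2,
      ∫ p in channel L, (w p i * pderiv j φ p + w p j * pderiv i φ p) / 2 = 0 := fun φ hφ i j => by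
    rw [← neg_eq_zero, ← h.2.2 φ hφ i j]
    refine integral_eq_zero_of_ae (hS.mono fun p hp => ?_)
    simp [hp]
  have h0 : (fun p => w p 0) =ᵐ[volume.restrict (channel L)] 0 := by
    refine ae_eq_zero_of_integral_mul_pderiv (MemLp.euclidean_apply hw 0) fun φ hφ => ?_
    simpa using hz φ hφ 0 0
  have h1 : (fun p => w p 1) =ᵐ[volume.restrict (channel L)] 0 := by
    refine ae_eq_zero_of_integral_mul_pderiv (MemLp.euclidean_apply hw 1) fun φ hφ => ?_
    -- Once `w 0` vanishes, the off-diagonal entry of the symmetric gradient says that `w 1` does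
    -- not vary along the channel either, so the same lemma applies. The affine form of rigid
    -- motions is never needed.
    have e : ∫ p in channel L, w p 1 * pderiv 0 φ p =
        2 * ∫ p in channel L, (w p 0 * pderiv 1 φ p + w p 1 * pderiv 0 φ p) / 2 := by
      rw [← integral_const_mul]
      refine integral_congr_ae (h0.mono fun p hp => ?_)
      simp only [Pi.zero_apply] at hp
      simp only [hp]
      ring
    rw [e, hz φ hφ 0 1, mul_zero]
  filter_upwards [h0, h1] with p hp0 hp1
  ext i
  fin_cases i
  · exact hp0
  · exact hp1

/-! ### The smooth class -/

variable {v w : ℝ × ℝ → Vel}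

/-- The classical gradient of a field on the closed channel. -/
noncomputable def closedGrad (L : ℝ) (v : ℝ × ℝ → Vel) (p : ℝ × ℝ) : Mat2 :=
  WithLp.toLp 2 fun ij => closedDeriv L ij.2 (fun q => v q ij.1) p

theorem MemSmooth.contDiffOn (hv : MemSmooth L v) (i : Fin 2) :
    ContDiffOn ℝ ∞ (fun p => v p i) (closure (channel L)) :=
  (EuclideanSpace.proj (𝕜 := ℝ) i).contDiff.comp_contDiffOn hv.1

theorem MemSmooth.exists_vanishesBeyond (hv : MemSmooth L v) :
    ∃ R, ∀ i, VanishesBeyond L R fun p => v p i := by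
  obtain ⟨K, hK, -, hz⟩ := hv.2.2.2
  obtain ⟨R, hR⟩ := hK.isBounded.subset_closedBall 0
  -- The ball is closed and `VanishesBeyond` includes `|x| = R`, hence the larger radius.
  refine ⟨R + 1, fun i p hp h => ?_⟩
  have hpK : p ∉ K := fun hpK => by
    have h1 := hR hpK
    rw [Metric.mem_closedBall, dist_zero_right] at h1
    have h2 := norm_fst_le p
    rw [Real.norm_eq_abs] at h2
    linarith
  simp only [hz p hp hpK, PiLp.zero_apply]

theorem MemSmooth.eq_zero_upper (hL : 0 < L) (hv : MemSmooth L v) (i : Fin 2) (x : ℝ) :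
    v (x, L) i = 0 := by
  obtain ⟨K, -, hK, hz⟩ := hv.2.2.2
  rw [hz (x, L) ((mem_closure_channel hL).2 ⟨hL.le, le_rfl⟩) fun h => lt_irrefl _ (hK h).2]
  rfl

theorem MemSmooth.sub (hv : MemSmooth L v) (hw : MemSmooth L w) : MemSmooth L (v - w) := by
  refine ⟨hv.1.sub hw.1, fun p hp => ?_, fun x => ?_, ?_⟩
  · have e : ∀ i j : Fin 2, pderiv j (fun q => (v - w) q i) p =
        pderiv j (fun q => v q i) p - pderiv j (fun q => w q i) p := fun i j => by
      have := ((differentiableAt_of_mem_channel (hv.contDiffOn i) hp).hasFDerivAt.fun_sub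
        (differentiableAt_of_mem_channel (hw.contDiffOn i) hp).hasFDerivAt).fderiv
      simp only [pderiv, Pi.sub_apply, PiLp.sub_apply, this, sub_apply]
    rw [e, e]
    linarith [hv.2.1 p hp, hw.2.1 p hp]
  · simp [hv.2.2.1, hw.2.2.1]
  · obtain ⟨K, hK, hKL, hKz⟩ := hv.2.2.2
    obtain ⟨K', hK', hKL', hKz'⟩ := hw.2.2.2
    refine ⟨K ∪ K', hK.union hK', Set.union_subset hKL hKL', fun p hp hpK => ?_⟩
    rw [Pi.sub_apply, hKz p hp fun h => hpK (Or.inl h), hKz' p hp fun h => hpK (Or.inr h), sub_zero]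

theorem MemSmooth.memL2 (hL : 0 < L) (hv : MemSmooth L v) : MemL2 L v := by
  obtain ⟨R, hR⟩ := hv.exists_vanishesBeyond
  exact MemLp.toEuclidean (f := fun p => (v p).ofLp)
    fun i => (hR i).memL2 hL (hv.contDiffOn i).continuousOn

theorem MemSmooth.memL2_closedGrad (hL : 0 < L) (hv : MemSmooth L v) :
    MemL2 L (closedGrad L v) := by
  obtain ⟨R, hR⟩ := hv.exists_vanishesBeyond
  exact MemLp.toEuclidean fun ij => ((hR ij.1).closedDeriv ij.2).memL2 hL
    (contDiffOn_closedDeriv hL (hv.contDiffOn ij.1) ij.2).continuousOn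

theorem MemSmooth.memLp_wall (hL : 0 < L) (hv : MemSmooth L v) :
    MemLp (restrictWall v) 2 volume := by
  obtain ⟨R, hR⟩ := hv.exists_vanishesBeyond
  exact MemLp.toEuclidean (f := fun x => (v (x, 0)).ofLp) fun i =>
    (continuous_wall hL (hv.contDiffOn i).continuousOn).memLp_of_hasCompactSupport
      ((hR i).hasCompactSupport_wall hL)

theorem MemSmooth.isWeakGrad (hL : 0 < L) (hv : MemSmooth L v) :
    IsWeakGrad L v (closedGrad L v) := by
  have h1 := (hv.memL2 hL).locallyIntegrableOn
  have h2 := (hv.memL2_closedGrad hL).locallyIntegrableOn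
  refine ⟨h1, h2, fun φ hφ i j => ?_⟩
  have hoff : ∀ f : ℝ × ℝ → ℝ, ∀ ψ, IsTest L ψ → ∀ p ∉ channel L, f p * ψ p = 0 :=
    fun f ψ hψ p hp => by rw [hψ.eq_zero hp, mul_zero]
  have hint : ∀ f : ℝ × ℝ → ℝ, ∀ ψ, IsTest L ψ → LocallyIntegrableOn f (channel L) →
      Integrable fun p => f p * ψ p := fun f ψ hψ hf =>
    (integrableOn_iff_integrable_of_support_subset fun p hp => by
      by_contra h; exact hp (hoff f ψ hψ p h)).1 (hψ.integrable_mul hf)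
  -- The integration by parts takes place in the whole plane, where `v` is arbitrary outside the
  -- closed channel. The factor `φ` hides this, and differentiability of `v` is needed only on its
  -- support.
  have e : (fun p => closedGrad L v p (i, j) * φ p) =
      fun p => fderiv ℝ (fun q => v q i) p (dir j) * φ p := by
    ext p
    by_cases hp : p ∈ channel L
    · simp only [closedGrad]
      rw [closedDeriv_eq_pderiv j hp, pderiv]
    · rw [hφ.eq_zero hp, mul_zero, mul_zero]
  have i1 := hint _ φ hφ (h2.euclidean_apply (i, j))
  rw [e] at i1
  rw [setIntegral_eq_integral_of_forall_compl_eq_zero (hoff _ φ hφ),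
    setIntegral_eq_integral_of_forall_compl_eq_zero (hoff _ _ (hφ.pderiv j)), e]
  exact (neg_eq_iff_eq_neg.2 (integral_mul_fderiv_eq_neg_fderiv_mul_of_integrable i1
    (hint _ _ (hφ.pderiv j) (h1.euclidean_apply i)) (hint _ φ hφ (h1.euclidean_apply i))
    (fun p hp => differentiableAt_of_mem_channel (hv.contDiffOn i) (hφ.2.2 hp))
    (fun p _ => hφ.1.differentiable (by simp) p))).symm

theorem MemSmooth.isWeakSymGrad (hL : 0 < L) (hv : MemSmooth L v) :
    IsWeakSymGrad L v (symPart (closedGrad L v)) :=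
  (hv.isWeakGrad hL).symPart (hv.memL2_closedGrad hL)

/-- Korn's inequality; the constant is exact for divergence-free fields. -/
theorem MemSmooth.korn (hL : 0 < L) (hv : MemSmooth L v) :
    ∫ p in channel L, ‖closedGrad L v p‖ ^ 2 ≤
      2 * ∫ p in channel L, ‖symPart (closedGrad L v) p‖ ^ 2 := by
  obtain ⟨R, hR⟩ := hv.exists_vanishesBeyond
  have hdet := integral_det_eq_zero hL (hv.contDiffOn 0) (hv.contDiffOn 1) (hR 0)
    (hv.eq_zero_upper hL 0) hv.2.2.1
  have hG := hv.memL2_closedGrad hL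
  have i1 : Integrable (fun p => 2 * ‖symPart (closedGrad L v) p‖ ^ 2)
      (volume.restrict (channel L)) := hG.symPart.integrable_norm_sq.const_mul 2
  have i2 := MemLp.integrable_norm_sq hG
  have h1 : ∫ p in channel L, (2 * ‖symPart (closedGrad L v) p‖ ^ 2 - ‖closedGrad L v p‖ ^ 2) =
      ∫ p in channel L, -2 * (closedDeriv L 0 (fun p => v p 0) p * closedDeriv L 1 (fun p => v p 1) p
        - closedDeriv L 1 (fun p => v p 0) p * closedDeriv L 0 (fun p => v p 1) p) := by
    refine setIntegral_congr_fun (measurableSet_channel L) fun p hp => ?_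
    have hdiv := hv.2.1 p hp
    rw [← closedDeriv_eq_pderiv 0 hp, ← closedDeriv_eq_pderiv 1 hp] at hdiv
    simp only [norm_sq_mat, SlipChannel.symPart, closedGrad]
    -- For a matrix `A` with symmetric part `S`, `2|S|² - |A|² = (tr A)² - 2 det A`; here the trace
    -- is the divergence.
    linear_combination (closedDeriv L 0 (fun p => v p 0) p +
      closedDeriv L 1 (fun p => v p 1) p) * hdiv
  rw [integral_const_mul, hdet, mul_zero, integral_sub i1 i2, integral_const_mul] at h1
  linarith

theorem norm_sq_vel (z : Vel) : ‖z‖ ^ 2 = z 0 ^ 2 + z 1 ^ 2 := by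
  rw [EuclideanSpace.real_norm_sq_eq, Fin.sum_univ_two]

theorem MemSmooth.integral_closedDeriv_le (hL : 0 < L) (hv : MemSmooth L v) :
    (∫ p in channel L, closedDeriv L 1 (fun q => v q 0) p ^ 2) +
      (∫ p in channel L, closedDeriv L 1 (fun q => v q 1) p ^ 2) ≤
      ∫ p in channel L, ‖closedGrad L v p‖ ^ 2 := by
  have hG := hv.memL2_closedGrad hL
  have h0 := (MemLp.euclidean_apply hG (0, 1)).integrable_sq
  have h1 := (MemLp.euclidean_apply hG (1, 1)).integrable_sq
  refine (integral_add h0 h1).symm.trans_le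
    (integral_mono (h0.add h1) (MemLp.integrable_norm_sq hG) fun p => ?_)
  simp only [norm_sq_mat]
  nlinarith [sq_nonneg (closedGrad L v p (0, 0)), sq_nonneg (closedGrad L v p (1, 0))]

theorem MemSmooth.poincare (hL : 0 < L) (hv : MemSmooth L v) :
    ∫ p in channel L, ‖v p‖ ^ 2 ≤
      16 * L ^ 2 / Real.pi ^ 2 * ∫ p in channel L, ‖closedGrad L v p‖ ^ 2 := by
  obtain ⟨R, hR⟩ := hv.exists_vanishesBeyond
  have h := fun i => poincare_estimate hL (hv.contDiffOn i) (hR i) (hv.eq_zero_upper hL i)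
  have hm := fun i => (MemLp.euclidean_apply (hv.memL2 hL) i).integrable_sq
  calc ∫ p in channel L, ‖v p‖ ^ 2
      = (∫ p in channel L, v p 0 ^ 2) + ∫ p in channel L, v p 1 ^ 2 := by
        simp only [norm_sq_vel]; exact integral_add (hm 0) (hm 1)
    _ ≤ 16 * L ^ 2 / Real.pi ^ 2 * ((∫ p in channel L, closedDeriv L 1 (fun q => v q 0) p ^ 2) +
          ∫ p in channel L, closedDeriv L 1 (fun q => v q 1) p ^ 2) := by
        rw [mul_add]; exact add_le_add (h 0) (h 1)
    _ ≤ _ := by gcongr; exact hv.integral_closedDeriv_le hL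

theorem MemSmooth.trace (hL : 0 < L) (hv : MemSmooth L v) :
    ∫ x, ‖restrictWall v x‖ ^ 2 ≤ 2 * L * ∫ p in channel L, ‖closedGrad L v p‖ ^ 2 := by
  obtain ⟨R, hR⟩ := hv.exists_vanishesBeyond
  have h := fun i => trace_estimate hL (hv.contDiffOn i) (hR i) (hv.eq_zero_upper hL i)
  have hm := fun i => (MemLp.euclidean_apply (hv.memLp_wall hL) i).integrable_sq
  calc ∫ x, ‖restrictWall v x‖ ^ 2
      = (∫ x, v (x, 0) 0 ^ 2) + ∫ x, v (x, 0) 1 ^ 2 := by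
        simp only [norm_sq_vel]; exact integral_add (hm 0) (hm 1)
    _ ≤ 2 * L * ((∫ p in channel L, closedDeriv L 1 (fun q => v q 0) p ^ 2) +
          ∫ p in channel L, closedDeriv L 1 (fun q => v q 1) p ^ 2) := by
        rw [mul_add]; exact add_le_add (h 0) (h 1)
    _ ≤ _ := by gcongr; exact hv.integral_closedDeriv_le hL

/-! ### The space `V_L` -/

theorem vNormSq_eq (α : ℝ) {u : ℝ × ℝ → Vel} {S : ℝ × ℝ → Mat2} (h : IsWeakSymGrad L u S)
    (g : ℝ → Vel) :
    vNormSq L α u g = (∫ p in channel L, ‖S p‖ ^ 2) + α * ∫ x, ‖g x‖ ^ 2 := by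
  rw [vNormSq, integral_weakSymGrad_sq h]

theorem vNormSq_nonneg {α : ℝ} (hα : 0 < α) (u : ℝ × ℝ → Vel) (g : ℝ → Vel) :
    0 ≤ vNormSq L α u g := by
  unfold vNormSq; positivity

theorem integral_symGrad_le_vNormSq {α : ℝ} (hα : 0 < α) {u : ℝ × ℝ → Vel} {S : ℝ × ℝ → Mat2}
    (h : IsWeakSymGrad L u S) (g : ℝ → Vel) :
    ∫ p in channel L, ‖S p‖ ^ 2 ≤ vNormSq L α u g := by
  rw [vNormSq_eq α h]
  have : 0 ≤ α * ∫ x, ‖g x‖ ^ 2 := by positivity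
  linarith

theorem integral_wall_le_vNormSq {α : ℝ} (hα : 0 < α) (u : ℝ × ℝ → Vel) (g : ℝ → Vel) :
    ∫ x, ‖g x‖ ^ 2 ≤ 1 / α * vNormSq L α u g := by
  rw [vNormSq, mul_add, ← mul_assoc, one_div_mul_cancel hα.ne', one_mul]
  have : 0 ≤ 1 / α * ∫ p in channel L, ‖weakSymGrad L u p‖ ^ 2 := by positivity
  linarith

theorem MemSmooth.closedGrad_le_vNormSq (hL : 0 < L) {α : ℝ} (hα : 0 < α) (hv : MemSmooth L v)
    (g : ℝ → Vel) : ∫ p in channel L, ‖closedGrad L v p‖ ^ 2 ≤ 2 * vNormSq L α v g :=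
  (hv.korn hL).trans
    (by gcongr; exact integral_symGrad_le_vNormSq hα (hv.isWeakSymGrad hL) g)

theorem MemSmooth.l2_le_vNormSq (hL : 0 < L) {α : ℝ} (hα : 0 < α) (hv : MemSmooth L v)
    (g : ℝ → Vel) : ∫ p in channel L, ‖v p‖ ^ 2 ≤ 32 * L ^ 2 / Real.pi ^ 2 * vNormSq L α v g :=
  (hv.poincare hL).trans <| by
    calc _ ≤ 16 * L ^ 2 / Real.pi ^ 2 * (2 * vNormSq L α v g) := by
          gcongr; exact hv.closedGrad_le_vNormSq hL hα g
      _ = _ := by ring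

/-- Two independent bounds compete: the wall term of the norm gives `1 / α`, and the trace
inequality followed by Korn gives `4L ≤ 8L`, which survives as `α → 0`. -/
theorem MemSmooth.wall_le_vNormSq (hL : 0 < L) {α : ℝ} (hα : 0 < α) (hv : MemSmooth L v) :
    ∫ x, ‖restrictWall v x‖ ^ 2 ≤ min (1 / α) (8 * L) * vNormSq L α v (restrictWall v) := by
  have h0 := vNormSq_nonneg (L := L) hα v (restrictWall v)
  rw [min_mul_of_nonneg _ _ h0]
  refine le_min (integral_wall_le_vNormSq hα v _) ((hv.trace hL).trans ?_)
  calc _ ≤ 2 * L * (2 * vNormSq L α v (restrictWall v)) := by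
        gcongr; exact hv.closedGrad_le_vNormSq hL hα _
    _ ≤ _ := by nlinarith [mul_nonneg hL.le h0]

theorem integral_symPart_sub_le {G H : ℝ × ℝ → Mat2} (hG : MemL2 L G) (hH : MemL2 L H) :
    ∫ p in channel L, ‖symPart G p - symPart H p‖ ^ 2 ≤ ∫ p in channel L, ‖G p - H p‖ ^ 2 := by
  have hd : MemL2 L (G - H) := MemLp.sub hG hH
  have h := integral_mono (MemLp.integrable_norm_sq hd.symPart) (MemLp.integrable_norm_sq hd)
    fun p => norm_symPart_sq_le _ p
  rw [symPart_sub] at h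
  exact h

/-- The limit of a sequence in the smooth class that is Cauchy in the `V_L`-norm, together with the
limit of the gradients. -/
theorem IsVCauchy.exists_limit (hL : 0 < L) {α : ℝ} (hα : 0 < α) {v : ℕ → ℝ × ℝ → Vel}
    (hv : IsVCauchy L α v) :
    ∃ u G g, MemL2 L u ∧ MemL2 L G ∧ MemLp g 2 volume ∧ IsWeakGrad L u G ∧
      Tendsto (fun n => ∫ p in channel L, ‖u p - v n p‖ ^ 2) atTop (𝓝 0) ∧
      Tendsto (fun n => ∫ p in channel L, ‖G p - closedGrad L (v n) p‖ ^ 2) atTop (𝓝 0) ∧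
      Tendsto (fun n => ∫ x, ‖g x - restrictWall (v n) x‖ ^ 2) atTop (𝓝 0) := by
  -- Any quantity whose squared `L²` differences are dominated by the `V_L`-norm is Cauchy; this is
  -- applied to the fields, their gradients and their wall values.
  have cauchy : ∀ {X F : Type} [MeasurableSpace X] [NormedAddCommGroup F] (μ : Measure X)
      (f : ℕ → X → F) (C : ℝ), 0 < C →
      (∀ m n, ∫ x, ‖f m x - f n x‖ ^ 2 ∂μ ≤
        C * vNormSq L α (v m - v n) (restrictWall (v m) - restrictWall (v n))) →
      ∀ ε > 0, ∃ N, ∀ m ≥ N, ∀ n ≥ N, ∫ x, ‖f m x - f n x‖ ^ 2 ∂μ < ε := by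
    intro X F _ _ μ f C hC hle ε hε
    obtain ⟨N, hN⟩ := hv.2 (ε / C) (by positivity)
    refine ⟨N, fun m hm n hn => (hle m n).trans_lt ?_⟩
    rw [mul_comm]
    exact (lt_div_iff₀ hC).1 (hN m hm n hn)
  have hs := fun m n => (hv.1 m).sub (hv.1 n)
  obtain ⟨u, hu, hu0⟩ := exists_memLp_tendsto_integral_sq (fun n => (hv.1 n).memL2 hL)
    (cauchy (volume.restrict (channel L)) v (32 * L ^ 2 / Real.pi ^ 2) (by positivity) fun m n =>
      (hs m n).l2_le_vNormSq hL hα _)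
  obtain ⟨G, hG, hG0⟩ := exists_memLp_tendsto_integral_sq (fun n => (hv.1 n).memL2_closedGrad hL)
    (cauchy (volume.restrict (channel L)) (fun n => closedGrad L (v n)) 2 two_pos fun m n => by
      -- Uniqueness of weak gradients yields `closedGrad L (v m - v n) = closedGrad L (v m) -
      -- closedGrad L (v n)` almost everywhere, which is enough under the integral.
      have h1 := (weakGrad_ae_eq ((hs m n).isWeakGrad hL)).symm.trans
        (weakGrad_ae_eq (((hv.1 m).isWeakGrad hL).sub ((hv.1 n).isWeakGrad hL)))
      refine le_trans (le_of_eq (integral_congr_ae ?_)) ((hs m n).closedGrad_le_vNormSq hL hα _)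
      filter_upwards [h1] with p hp
      rw [hp, Pi.sub_apply])
  obtain ⟨g, hg, hg0⟩ := exists_memLp_tendsto_integral_sq (fun n => (hv.1 n).memLp_wall hL)
    (cauchy volume (fun n => restrictWall (v n)) (1 / α) (by positivity) fun m n =>
      integral_wall_le_vNormSq hα _ _)
  exact ⟨u, G, g, hu, hG, hg, IsWeakGrad.of_tendsto (fun n => (hv.1 n).isWeakGrad hL)
    (fun n => (hv.1 n).memL2 hL) (fun n => (hv.1 n).memL2_closedGrad hL) hu hG hu0 hG0,
    hu0, hG0, hg0⟩

theorem tendsto_vNormSq_sub (hL : 0 < L) (α : ℝ) {v : ℕ → ℝ × ℝ → Vel}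
    (hv : ∀ n, MemSmooth L (v n)) {u : ℝ × ℝ → Vel} {G : ℝ × ℝ → Mat2} {g : ℝ → Vel}
    (hG : MemL2 L G) (huG : IsWeakGrad L u G)
    (hG0 : Tendsto (fun n => ∫ p in channel L, ‖G p - closedGrad L (v n) p‖ ^ 2) atTop (𝓝 0))
    (hg0 : Tendsto (fun n => ∫ x, ‖g x - restrictWall (v n) x‖ ^ 2) atTop (𝓝 0)) :
    Tendsto (fun n => vNormSq L α (u - v n) (g - restrictWall (v n))) atTop (𝓝 0) := by
  have hS : Tendsto (fun n => ∫ p in channel L, ‖symPart G p - symPart (closedGrad L (v n)) p‖ ^ 2)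
      atTop (𝓝 0) :=
    squeeze_zero (fun n => by positivity)
      (fun n => integral_symPart_sub_le hG ((hv n).memL2_closedGrad hL)) hG0
  have := hS.add (hg0.const_mul α)
  rw [mul_zero, add_zero] at this
  refine this.congr fun n => ?_
  rw [vNormSq_eq α ((huG.symPart hG).sub ((hv n).isWeakSymGrad hL))]
  rfl

theorem IsVCauchy.exists_memV (hL : 0 < L) {α : ℝ} (hα : 0 < α) {v : ℕ → ℝ × ℝ → Vel}
    (hv : IsVCauchy L α v) :
    ∃ u g, MemV L α u g ∧
      Tendsto (fun n => vNormSq L α (u - v n) (g - restrictWall (v n))) atTop (𝓝 0) := by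
  obtain ⟨u, G, g, hu, hG, hg, huG, -, hG0, hg0⟩ := hv.exists_limit hL hα
  have h := tendsto_vNormSq_sub hL α hv.1 hG huG hG0 hg0
  exact ⟨u, g, ⟨⟨hu, ⟨_, huG.symPart hG, hG.symPart⟩, hg⟩, v, hv.1, h⟩, h⟩

/-- Every element of `V_L` is the limit of fields in the smooth class in `W^{1,2}` and in `L²` of
the wall. -/
theorem MemV.exists_approximation (hL : 0 < L) {α : ℝ} (hα : 0 < α) {u : ℝ × ℝ → Vel}
    {g : ℝ → Vel} (h : MemV L α u g) :
    ∃ (v : ℕ → ℝ × ℝ → Vel) (G : ℝ × ℝ → Mat2), (∀ n, MemSmooth L (v n)) ∧ IsWeakGrad L u G ∧ MemL2 L G ∧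
      Tendsto (fun n => ∫ p in channel L, ‖u p - v n p‖ ^ 2) atTop (𝓝 0) ∧
      Tendsto (fun n => ∫ p in channel L, ‖G p - closedGrad L (v n) p‖ ^ 2) atTop (𝓝 0) ∧
      Tendsto (fun n => ∫ x, ‖g x - restrictWall (v n) x‖ ^ 2) atTop (𝓝 0) ∧
      Tendsto (fun n => vNormSq L α (v n) (restrictWall (v n))) atTop (𝓝 (vNormSq L α u g)) := by
  obtain ⟨⟨hu, ⟨S, hS, hS2⟩, hg⟩, v, hv, hlim⟩ := h
  have hsm := fun n => (hv n).isWeakSymGrad hL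
  have hT : ∀ n, MemL2 L (symPart (closedGrad L (v n))) :=
    fun n => ((hv n).memL2_closedGrad hL).symPart
  have ht := fun n => (hv n).memLp_wall hL
  have lS : Tendsto (fun n => ∫ p in channel L, ‖S p - symPart (closedGrad L (v n)) p‖ ^ 2)
      atTop (𝓝 0) :=
    squeeze_zero (fun n => by positivity)
      (fun n => integral_symGrad_le_vNormSq hα (hS.sub (hsm n)) _) hlim
  have lg : Tendsto (fun n => ∫ x, ‖g x - restrictWall (v n) x‖ ^ 2) atTop (𝓝 0) := by
    have := hlim.const_mul (1 / α)
    rw [mul_zero] at this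
    exact squeeze_zero (fun n => by positivity)
      (fun n => integral_wall_le_vNormSq hα _ (g - restrictWall (v n))) this
  have hc : IsVCauchy L α v := by
    refine ⟨hv, fun ε hε => ?_⟩
    -- The squared triangle inequality costs a factor 2, and `2 (ε/4 + ε/4) = ε`.
    obtain ⟨N, hN⟩ := eventually_atTop.1 ((tendsto_order.1 hlim).2 (ε / 4) (by positivity))
    refine ⟨N, fun m hm n hn => ?_⟩
    rw [vNormSq_eq α ((hsm m).sub (hsm n))]
    have h1 := integral_norm_sub_sq_le (hT m) hS2 (hT n)
    have h2 := mul_le_mul_of_nonneg_left (integral_norm_sub_sq_le (ht m) hg (ht n)) hα.le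
    have h3 := hN m hm
    have h4 := hN n hn
    rw [vNormSq_eq α (hS.sub (hsm _))] at h3 h4
    simp only [Pi.sub_apply] at h3 h4 ⊢
    linarith
  -- So far `u'` is unrelated to `u`: only the symmetric gradients of `v n` are known to approach
  -- that of `u`. The wall limit needs no such identification, as `lg` already gives convergence to
  -- `g`.
  obtain ⟨u', G, g', hu', hG, -, huG, hu0, hG0, -⟩ := hc.exists_limit hL hα
  have lS' : Tendsto (fun n => ∫ p in channel L, ‖symPart G p - symPart (closedGrad L (v n)) p‖ ^ 2)
      atTop (𝓝 0) :=
    squeeze_zero (fun n => by positivity)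
      (fun n => integral_symPart_sub_le hG ((hv n).memL2_closedGrad hL)) hG0
  have hSG := ae_eq_of_tendsto_integral_sq hT hS2 hG.symPart lS lS'
  -- Both symmetric gradients are `L²`-limits of one sequence, so `u - u'` is square integrable with
  -- zero symmetric gradient.
  have huu : u =ᵐ[volume.restrict (channel L)] u' := by
    have h1 := ae_eq_zero_of_isWeakSymGrad (MemLp.sub hu hu') (hS.sub (huG.symPart hG))
      (hSG.mono fun p hp => by simp [hp])
    exact h1.mono fun p hp => sub_eq_zero.1 hp
  refine ⟨v, G, hv, ⟨hS.1, huG.2.1, fun φ hφ i j => ?_⟩, hG, ?_, hG0, lg, ?_⟩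
  · rw [huG.2.2 φ hφ i j]
    congr 1
    exact integral_congr_ae (huu.mono fun p hp => by simp only [hp])
  · exact hu0.congr fun n => integral_congr_ae (huu.mono fun p hp => by simp only [hp])
  · simp only [vNormSq_eq α hS, vNormSq_eq α (hsm _)]
    exact (tendsto_integral_norm_sq hT hS2 lS).add ((tendsto_integral_norm_sq ht hg lg).const_mul α)

theorem MemV.memW12 (hL : 0 < L) {α : ℝ} (hα : 0 < α) {u : ℝ × ℝ → Vel} {g : ℝ → Vel}
    (h : MemV L α u g) : MemW12 L u ∧
      w12NormSq L u ≤ 8 * (1 + 4 * L ^ 2 / Real.pi ^ 2) * vNormSq L α u g := by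
  obtain ⟨v, G, hv, huG, hG, hu0, hG0, -, hV⟩ := h.exists_approximation hL hα
  refine ⟨⟨h.1.1, G, huG, hG⟩, ?_⟩
  rw [w12NormSq, integral_weakGrad_sq huG]
  refine le_of_tendsto_of_tendsto'
    ((tendsto_integral_norm_sq (fun n => (hv n).memL2 hL) h.1.1 hu0).add
      (tendsto_integral_norm_sq (fun n => (hv n).memL2_closedGrad hL) hG hG0))
    (hV.const_mul _) fun n => ?_
  have h1 := (hv n).l2_le_vNormSq hL hα (restrictWall (v n))
  have h2 := (hv n).closedGrad_le_vNormSq hL hα (restrictWall (v n))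
  have h3 := vNormSq_nonneg (L := L) hα (v n) (restrictWall (v n))
  -- The Poincaré part uses exactly `32 L² / π²`; the gradient part needs only 2 of the available 8.
  have e : 8 * (1 + 4 * L ^ 2 / Real.pi ^ 2) = 8 + 32 * L ^ 2 / Real.pi ^ 2 := by ring
  rw [e, add_mul]
  linarith

theorem MemV.memH (hL : 0 < L) {α β : ℝ} (hα : 0 < α) (hβ : 0 < β) {u : ℝ × ℝ → Vel}
    {g : ℝ → Vel} (h : MemV L α u g) : MemH L β u g ∧
      hNormSq L β u g ≤
        (32 * L ^ 2 / Real.pi ^ 2 + β * min (1 / α) (8 * L)) * vNormSq L α u g := by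
  obtain ⟨v, G, hv, -, -, hu0, -, hg0, hV⟩ := h.exists_approximation hL hα
  refine ⟨⟨⟨h.1.1, h.1.2.2⟩, v, hv, ?_⟩, ?_⟩
  · have := hu0.add (hg0.const_mul β)
    rw [mul_zero, add_zero] at this
    exact this
  · refine le_of_tendsto_of_tendsto'
      ((tendsto_integral_norm_sq (fun n => (hv n).memL2 hL) h.1.1 hu0).add
        ((tendsto_integral_norm_sq (fun n => (hv n).memLp_wall hL) h.1.2.2 hg0).const_mul β))
      (hV.const_mul _) fun n => ?_
    rw [add_mul, mul_assoc]
    exact add_le_add ((hv n).l2_le_vNormSq hL hα _)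
      (mul_le_mul_of_nonneg_left ((hv n).wall_le_vNormSq hL hα) hβ.le)

end SlipChannel

theorem mainTheorem4 (L α β : ℝ) (hL : 0 < L) (hα : 0 < α) (hβ : 0 < β) :
    -- the closure defining `V_L` is complete: it is the whole completion of the smooth class
    (∀ v : ℕ → ℝ × ℝ → SlipChannel.Vel, SlipChannel.IsVCauchy L α v →
      ∃ u g, SlipChannel.MemV L α u g ∧
        Filter.Tendsto
          (fun n => SlipChannel.vNormSq L α (u - v n) (g - SlipChannel.restrictWall (v n)))
          Filter.atTop (nhds 0)) ∧
    -- the two estimates on `V_L`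
    (∀ (u : ℝ × ℝ → SlipChannel.Vel) (g : ℝ → SlipChannel.Vel), SlipChannel.MemV L α u g →
      (SlipChannel.MemW12 L u ∧
        SlipChannel.w12NormSq L u ≤
          8 * (1 + 4 * L ^ 2 / Real.pi ^ 2) * SlipChannel.vNormSq L α u g) ∧
      (SlipChannel.MemH L β u g ∧
        SlipChannel.hNormSq L β u g ≤
          (32 * L ^ 2 / Real.pi ^ 2 + β * min (1 / α) (8 * L)) *
            SlipChannel.vNormSq L α u g)) :=
  ⟨fun _ hv => hv.exists_memV hL hα,
    fun _ _ h => ⟨h.memW12 hL hα, h.memH hL hα hβ⟩⟩
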